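/- **Setting.** Strings are words $\mathbf a\in\Sigma^*$ over the alphabet $\Sigma=\{\mathtt 0,\mathtt 1,\mathtt{.}\}$ (binary digits and a separator), $|\mathbf a|$ is the length of $\mathbf a$, and $\mathcal B$ is the set of all functions $\Sigma^*\to\Sigma^*$. An *oracle machine* $M^?$ is a deterministic multi-tape Turing machine with an input tape, an output tape, an oracle query tape, an oracle answer tape and finitely many work tapes; in its oracle state, with oracle $\varphi\in\mathcal B$, it replaces in one step the content of the answer tape by $\varphi(\mathbf b)$, where $\mathbf b$ is the content of the query tape, without moving any head. $\mathrm{Time}_{M^?}(\varphi,\mathbf a)\in\mathbb N\cup\{\infty\}$ is the number of steps on input $\mathbf a$ with oracle $\varphi$. If $M^?$ halts on all inputs with oracle $\varphi$, then $M^\varphi\in\mathcal B$ is the function that maps each input to the resulting output. The class of *second-order polynomials* is the smallest class of maps $P:\mathbb N^{\mathbb N}\times\mathbb N\to\mathbb N$ that contains $(l,n)\mapsto p(n)$ for $p\in\mathbb N[X]$ and is closed under $P\mapsto\big((l,n)\mapsto l(P(l,n))\big)$, pointwise sums and pointwise products. **Codes.** An integer is coded by a sign bit followed by its binary expansion without leading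 zeros (strings with no digit after the sign code $0$). A dyadic number is coded by a code of an integer, the separator and binary digits after the point. The pairing $\langle\mathbf a,\mathbf b\rangle$ interleaves letter by letter three strings, all padded with zeros to the same length $\max\{|\mathbf a|,|\mathbf b|,\min\{|\mathbf a|,|\mathbf b|\}+2\}$: a control string consisting of $\min\{|\mathbf a|,|\mathbf b|\}$ ones, a zero, and a bit telling which of $\mathbf a,\mathbf b$ is longer; then $\mathbf a$; then $\mathbf b$. The interval $[r-\varepsilon,r+\varepsilon]$ ($r,\varepsilon$ dyadic, $\varepsilon\ge 0$) is coded by the pairing of a code of $r$ and a code of $\varepsilon$, and the infinite interval $[-\infty,\infty]$ by the empty string. **Interval reals.** A function $\varphi\in\mathcal B$ is a *name* of $x\in\mathbb R$ if there are intervals $I_0\supseteq I_1\supseteq\cdots$, each a finite dyadic interval or $[-\infty,\infty]$, with $\bigcap_n I_n=\{x\}$, such that $\varphi$ maps every code of the integer $2^n$ to a code of $I_n$, for all $n$. The *parameter* of such a name is $$\mu(\varphi)(n)=\min\{N\mid \operatorname{diam}(I_N)\le 2^{-n}\}+\lceil\log_2(|x|+1)\rceil .$$ $\mathbb R_i$ denotes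 $\mathbb R$ with these names and this parameter. A machine $M^?$ *computes* a partial function $f:\subseteq\mathbb R\to\mathbb R$ if, for every name $\varphi$ of a point $x\in\operatorname{dom}f$, $M^\varphi$ is defined and is a name of $f(x)$. The partial function $f:\subseteq\mathbb R_i\to\mathbb R_i$ is *polytime computable* if there are a machine $N^?$ computing $f$ and second-order polynomials $P_0,Q_0$ such that, for all names $\varphi$ of points of $\operatorname{dom}f$, all $\mathbf a\in\Sigma^*$ and all $n\in\mathbb N$, $$\mathrm{Time}_{N^?}(\varphi,\mathbf a)\le P_0(\mu(\varphi),|\mathbf a|)\quad\text{and}\quad \mu(N^\varphi)(n)\le Q_0(\mu(\varphi),n).$$ **Theorem.** Whenever $f:\subseteq\mathbb R_i\to\mathbb R_i$ is polytime computable, there are an oracle machine $M^?$ that computes $f$, a constant $C\in\mathbb N$ and a second-order polynomial $P$ such that $$\mathrm{Time}_{M^?}(\varphi,\mathbf a)\le C\cdot|\mathbf a|+C\qquad\text{for all }\varphi\in\mathcal B\text{ and all }\mathbf a\in\Sigma^*,$$ and $$\mu(M^\varphi)(n)\le P(\mu(\varphi),n)\qquad\text{for all names }\varphi\text{ of points of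 }\operatorname{dom}f\text{ and all }n\in\mathbb N.$$ -/

import Mathlib

/-! ### Strings and oracles -/

/-- The alphabet: the two binary digits and the separator (the binary point). -/
inductive Letter
  | zero
  | one
  | sep

/-- The space of all string functions (the oracles). -/
abbrev StringFun : Type := List Letter → List Letter

/-! ### Oracle Turing machines -/

/-- The tapes of an oracle machine: input, output, oracle query, oracle answer, and work tapes. -/
inductive TapeName (W : Type)
  | input
  | output
  | query
  | answer
  | work (w : W)

/-- Movement of a head in one step. -/
inductive HeadMove
  | left
  | stay
  | right

def HeadMove.toInt : HeadMove → ℤ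
  | .left => -1
  | .stay => 0
  | .right => 1

/-- Contents of a tape cell: blank (`none`), a letter, or one of the machine's auxiliary symbols. -/
abbrev TapeCell (A : Type) : Type := Option (Letter ⊕ A)

/-- A deterministic multi-tape oracle Turing machine with two-way infinite tapes.
`ask` is the oracle state; after an oracle call the machine continues in the state `resume`. -/
structure OracleMachine where
  State : Type
  Aux : Type
  Work : Type
  finite_state : Finite State
  finite_aux : Finite Aux
  finite_work : Finite Work
  start : State
  ask : State
  resume : State
  halt : State
  /-- From the state and the scanned cells: the new state, the cells written, the head moves. -/
  trans : State → (TapeName Work → TapeCell Aux) →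
    State × (TapeName Work → TapeCell Aux × HeadMove)

/-- The letter in a cell, if it holds a letter. -/
def TapeCell.letter {A : Type} : TapeCell A → Option Letter
  | some (.inl s) => some s
  | _ => none

/-- The tape with the string `s` in the cells `0, 1, 2, …` and blanks elsewhere. -/
def writtenTape {A : Type} (s : List Letter) : ℤ → TapeCell A
  | .ofNat i => (s[i]?).map Sum.inl
  | .negSucc _ => none

open Classical in
/-- The content of a tape: the letters in the cells `0, 1, 2, …` up to the first cell that does not
hold a letter. (On the tapes that occur in computations there always is such a cell.) -/
noncomputable def tapeContent {A : Type} (T : ℤ → TapeCell A) : List Letter :=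
  if h : ∃ n : ℕ, (T n).letter = none then
    (List.range (Nat.find h)).filterMap fun i : ℕ => (T i).letter
  else []

namespace OracleMachine

structure Config (M : OracleMachine) where
  state : M.State
  tape : TapeName M.Work → ℤ → TapeCell M.Aux
  head : TapeName M.Work → ℤ

/-- Initially the input is on the input tape, all other tapes are blank, all heads are at `0`. -/
def init (M : OracleMachine) (a : List Letter) : M.Config where
  state := M.start
  tape
    | .input => writtenTape a
    | _ => fun _ => none
  head _ := 0

open Classical in
/-- One step with oracle `φ`. In the oracle state, the step replaces the content of the answer tape
by the value of `φ` on the content of the query tape, and no head moves. -/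
noncomputable def step (M : OracleMachine) (φ : StringFun) (c : M.Config) : M.Config :=
  if c.state = M.halt then c
  else if c.state = M.ask then
    { state := M.resume
      tape := fun
        | .answer => writtenTape (φ (tapeContent (c.tape .query)))
        | t => c.tape t
      head := c.head }
  else
    let r := M.trans c.state fun t => c.tape t (c.head t)
    { state := r.1
      tape := fun t => Function.update (c.tape t) (c.head t) (r.2 t).1
      head := fun t => c.head t + (r.2 t).2.toInt }

/-- The configuration after `n` steps on input `a` with oracle `φ`. -/
noncomputable def run (M : OracleMachine) (φ : StringFun) (a : List Letter) (n : ℕ) : M.Config :=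
  (M.step φ)^[n] (M.init a)

def HaltsAfter (M : OracleMachine) (φ : StringFun) (a : List Letter) (n : ℕ) : Prop :=
  (M.run φ a n).state = M.halt

/-- The number of steps on input `a` with oracle `φ`; it is `⊤` if the machine does not halt. -/
noncomputable def time (M : OracleMachine) (φ : StringFun) (a : List Letter) : ℕ∞ :=
  ⨅ (n : ℕ) (_ : M.HaltsAfter φ a n), (n : ℕ∞)

open Classical in
/-- The partial operator computed by the machine: it is defined at the oracles with which the
machine halts on every input, and its value is the function mapping an input to the final content of
the output tape. -/
noncomputable def operator (M : OracleMachine) : StringFun →. StringFun := fun φ =>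
  { Dom := ∀ a, ∃ n, M.HaltsAfter φ a n
    get := fun h a => tapeContent ((M.run φ a (Nat.find (h a))).tape .output) }

end OracleMachine

/-! ### Second-order polynomials -/

/-- The smallest class of functionals that contains the polynomials in the number argument and is
closed under application of the function argument, sums and products. -/
inductive IsSecondOrderPolynomial : ((ℕ → ℕ) → ℕ → ℕ) → Prop
  | poly (p : Polynomial ℕ) : IsSecondOrderPolynomial fun _ n => p.eval n
  | app {P : (ℕ → ℕ) → ℕ → ℕ} :
      IsSecondOrderPolynomial P → IsSecondOrderPolynomial fun l n => l (P l n)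
  | add {P Q : (ℕ → ℕ) → ℕ → ℕ} : IsSecondOrderPolynomial P → IsSecondOrderPolynomial Q →
      IsSecondOrderPolynomial fun l n => P l n + Q l n
  | mul {P Q : (ℕ → ℕ) → ℕ → ℕ} : IsSecondOrderPolynomial P → IsSecondOrderPolynomial Q →
      IsSecondOrderPolynomial fun l n => P l n * Q l n

/-! ### Preparametrised spaces and polynomial-time computability -/

/-- A set with a representation (a partial surjection from the string functions) and a parameter
assigning to each name a non-decreasing function. Values of `param` outside the domain of `rep` are
irrelevant. -/
structure PreparametrisedSpace (X : Type*) where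
  rep : StringFun →. X
  rep_surjective : ∀ x, ∃ φ, x ∈ rep φ
  param : StringFun → ℕ → ℕ
  param_mono : ∀ φ, (rep φ).Dom → ∀ n, param φ n ≤ param φ (n + 1)

/-- `F` is a realiser of the partial function `f`: it maps names of points `x` in the domain of `f`
to names of `f x`. -/
def IsRealiser {X Y : Type*} (SX : PreparametrisedSpace X) (SY : PreparametrisedSpace Y)
    (F : StringFun →. StringFun) (f : X →. Y) : Prop :=
  ∀ φ x y, x ∈ SX.rep φ → y ∈ f x → ∃ ψ ∈ F φ, y ∈ SY.rep ψ

/-- `Q` bounds the parameter blowup of `M` on the names of points in the domain of `f`. -/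
def BlowupBoundedBy {X Y : Type*} (SX : PreparametrisedSpace X) (SY : PreparametrisedSpace Y)
    (M : OracleMachine) (f : X →. Y) (Q : (ℕ → ℕ) → ℕ → ℕ) : Prop :=
  ∀ φ x, x ∈ SX.rep φ → (f x).Dom →
    ∀ ψ ∈ M.operator φ, ∀ n, SY.param ψ n ≤ Q (SX.param φ) n

/-- Polynomial-time computability of a partial function between preparametrised spaces. -/
def IsPolytimeComputable {X Y : Type*} (SX : PreparametrisedSpace X) (SY : PreparametrisedSpace Y)
    (f : X →. Y) : Prop :=
  ∃ (M : OracleMachine) (P Q : (ℕ → ℕ) → ℕ → ℕ),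
    IsSecondOrderPolynomial P ∧ IsSecondOrderPolynomial Q ∧
    IsRealiser SX SY M.operator f ∧
    (∀ φ x, x ∈ SX.rep φ → (f x).Dom → ∀ a, M.time φ a ≤ (P (SX.param φ) a.length : ℕ∞)) ∧
    BlowupBoundedBy SX SY M f Q

/-! ### Codes of integers, dyadic numbers and dyadic intervals -/

def Letter.ofBit : Bool → Letter
  | false => .zero
  | true => .one

/-- The number with the given binary digits, most significant digit first. -/
def binaryValue (w : List Bool) : ℕ := w.foldl (fun v b => 2 * v + b.toNat) 0

/-- `SignedCode c s m`: the string `c` consists of a sign bit `s` (`true` means negative) and the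
binary expansion of `m` without leading zeros. A string without a digit after the sign codes zero. -/
inductive SignedCode : List Letter → Bool → ℕ → Prop
  | empty : SignedCode [] false 0
  | sign (s : Bool) : SignedCode [Letter.ofBit s] s 0
  | digits (s : Bool) (w : List Bool) :
      SignedCode (Letter.ofBit s :: Letter.one :: w.map Letter.ofBit) s (binaryValue (true :: w))

/-- The string `a` is a code of the integer `z`. -/
def IsIntCode (a : List Letter) (z : ℤ) : Prop :=
  ∃ s m, SignedCode a s m ∧ z = if s then -(m : ℤ) else m

/-- The string `a` is a code of the dyadic number `q`: an integer code, the separator, and the binary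
digits after the point. -/
def IsDyadicCode (a : List Letter) (q : ℚ) : Prop :=
  ∃ c s m, ∃ w : List Bool, SignedCode c s m ∧ a = c ++ Letter.sep :: w.map Letter.ofBit ∧
    q = (if s then -1 else 1) * (m + binaryValue w / 2 ^ w.length)

def interleave : List Letter → List Letter → List Letter → List Letter
  | x :: u, y :: v, z :: w => x :: y :: z :: interleave u v w
  | _, _, _ => []

/-- Append zeros up to the length `L`. -/
def padTo (L : ℕ) (a : List Letter) : List Letter := a ++ List.replicate (L - a.length) Letter.zero

/-- The pairing of strings: the first of three interleaved tracks consists of as many ones as the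
shorter string has letters, a zero, a bit telling which string is longer, and zeros; the other two
tracks are the strings. All tracks are padded with zeros to equal length. -/
def pairString (a b : List Letter) : List Letter :=
  let m := min a.length b.length
  let L := max (max a.length b.length) (m + 2)
  interleave
    (padTo L (List.replicate m Letter.one ++
      [Letter.zero, Letter.ofBit (decide (a.length < b.length))]))
    (padTo L a) (padTo L b)

/-- An interval: the infinite one, or `[r - ε, r + ε]`. (Only those with dyadic `r` and `ε ≥ 0` have
codes.) -/
inductive CodedInterval
  | infinite
  | finite (r ε : ℚ)

namespace CodedInterval

/-- The real numbers in the interval. -/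
def toSet : CodedInterval → Set ℝ
  | infinite => Set.univ
  | finite r ε => Set.Icc ((r : ℝ) - ε) (r + ε)

def diam : CodedInterval → WithTop ℚ
  | infinite => ⊤
  | finite _ ε => ((2 * ε : ℚ) : WithTop ℚ)

end CodedInterval

/-- `IsIntervalCode s I`: the string `s` is a code of `I`. The empty string codes the infinite
interval; a pair of codes of `r` and `ε ≥ 0` codes `[r - ε, r + ε]`. -/
inductive IsIntervalCode : List Letter → CodedInterval → Prop
  | infinite : IsIntervalCode [] CodedInterval.infinite
  | finite {a b : List Letter} {r ε : ℚ} : IsDyadicCode a r → IsDyadicCode b ε → 0 ≤ ε →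
      IsIntervalCode (pairString a b) (CodedInterval.finite r ε)

/-! ### The preparametrised space of interval reals -/

/-- The string function `ψ` encodes the sequence `I` of intervals; the index `n` is given by the
integer `2 ^ n`, that is, in unary. -/
def EncodesIntervals (ψ : StringFun) (I : ℕ → CodedInterval) : Prop :=
  ∀ n a, IsIntCode a (2 ^ n) → IsIntervalCode (ψ a) (I n)

/-- `ψ` is a name of the real number `x`: it encodes a nested sequence of intervals whose intersection
is `{x}`. -/
def IsIntervalName (ψ : StringFun) (x : ℝ) : Prop :=
  ∃ I, EncodesIntervals ψ I ∧ (∀ n, (I (n + 1)).toSet ⊆ (I n).toSet) ∧ ⋂ n, (I n).toSet = {x}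

/-- The interval representation of the real numbers, as a partial function
(see `mem_intervalRep`). -/
noncomputable def intervalRep : StringFun →. ℝ := fun ψ =>
  { Dom := ∃ x, IsIntervalName ψ x
    get := fun h => h.choose }

open Classical in
/-- The parameter of a name of `x`: the least index at which the encoded interval has diameter at most
`2⁻ⁿ`, plus `⌈log₂ (|x| + 1)⌉`. -/
noncomputable def intervalParam (ψ : StringFun) (n : ℕ) : ℕ :=
  sInf {N | ∃ I, EncodesIntervals ψ I ∧ (I N).diam ≤ (((2 : ℚ) ^ n)⁻¹ : ℚ)} +
    ⌈Real.logb 2 (|(intervalRep ψ).getOrElse 0| + 1)⌉₊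

theorem binaryValue_append (w : List Bool) (b : Bool) :
    binaryValue (w ++ [b]) = 2 * binaryValue w + b.toNat := by
  simp [binaryValue]

theorem binaryValue_append_zeros (w : List Bool) (k : ℕ) :
    binaryValue (w ++ List.replicate k false) = binaryValue w * 2 ^ k := by
  induction k with
  | zero => simp
  | succ k ih =>
    rw [List.replicate_succ', ← List.append_assoc, binaryValue_append, ih]
    simp; ring

theorem binaryValue_bounds (w : List Bool) :
    2 ^ w.length ≤ binaryValue (true :: w) ∧ binaryValue (true :: w) < 2 ^ (w.length + 1) := by
  induction w using List.reverseRecOn with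
  | nil => simp [binaryValue]
  | append_singleton w b ih =>
    rw [← List.cons_append, binaryValue_append]
    have hb : b.toNat ≤ 1 := by cases b <;> simp
    simp only [List.length_append, List.length_singleton, pow_succ] at *
    omega

theorem isIntCode_two_pow (n : ℕ) :
    IsIntCode (Letter.zero :: Letter.one :: List.replicate n Letter.zero) (2 ^ n) := by
  refine ⟨false, binaryValue (true :: List.replicate n false), ?_, ?_⟩
  · have := SignedCode.digits false (List.replicate n false)
    simpa [Letter.ofBit] using this
  · have := binaryValue_append_zeros [true] n
    simp only [List.singleton_append] at this
    rw [this]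
    simp [binaryValue]

theorem IsIntCode.length_eq {a : List Letter} {n : ℕ} (h : IsIntCode a (2 ^ n)) :
    a.length = n + 2 := by
  obtain ⟨s, m, hc, hz⟩ := h
  have hpos : (0 : ℤ) < 2 ^ n := by positivity
  cases hc with
  | empty => simp at hz
  | sign s => cases s <;> simp at hz
  | digits s w =>
    obtain ⟨h1, h2⟩ := binaryValue_bounds w
    cases s with
    | true => simp only [if_true] at hz; omega
    | false =>
      have hz' : 2 ^ n = binaryValue (true :: w) := by
        simp only [Bool.false_eq_true, if_false] at hz; exact_mod_cast hz
      rw [← hz'] at h1 h2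
      have h3 := (Nat.pow_le_pow_iff_right (by norm_num : 1 < 2)).1 h1
      have h4 := (Nat.pow_lt_pow_iff_right (by norm_num : 1 < 2)).1 h2
      simp only [List.length_cons, List.length_map]
      omega

theorem Letter.ofBit_injective : Function.Injective Letter.ofBit := by
  intro a b; cases a <;> cases b <;> simp [Letter.ofBit]

theorem SignedCode.functional {c : List Letter} {s s' : Bool} {m m' : ℕ}
    (h : SignedCode c s m) (h' : SignedCode c s' m') : s = s' ∧ m = m' := by
  generalize hc : c = c' at h'
  cases h <;> cases h' <;> simp only [List.cons.injEq, reduceCtorEq, and_false] at hc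
  · exact ⟨rfl, rfl⟩
  · exact ⟨Letter.ofBit_injective hc.1, rfl⟩
  · exact ⟨Letter.ofBit_injective hc.1,
      by rw [List.map_injective_iff.2 Letter.ofBit_injective hc.2.2]⟩

theorem SignedCode.sep_notMem {c : List Letter} {s : Bool} {m : ℕ} (h : SignedCode c s m) :
    Letter.sep ∉ c := by
  have ofBit_ne : ∀ b, Letter.sep ≠ Letter.ofBit b := by
    intro b; cases b <;> simp [Letter.ofBit]
  cases h with
  | empty => simp
  | sign s => simpa using ofBit_ne s
  | digits s w => simp [ofBit_ne, fun b => (ofBit_ne b).symm]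

theorem IsDyadicCode.functional {a : List Letter} {q q' : ℚ}
    (h : IsDyadicCode a q) (h' : IsDyadicCode a q') : q = q' := by
  obtain ⟨c, s, m, w, hc, ha, hq⟩ := h
  obtain ⟨c', s', m', w', hc', ha', hq'⟩ := h'
  have key : ∀ (u u' v v' : List Letter), Letter.sep ∉ u → Letter.sep ∉ u' →
      u ++ Letter.sep :: v = u' ++ Letter.sep :: v' → u = u' ∧ v = v' := by
    intro u
    induction u with
    | nil =>
      intro u' v v' _ h2 h
      cases u' with
      | nil => simpa using h
      | cons x u' => simp at h h2; exact absurd h.1 h2.1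
    | cons y u ih =>
      intro u' v v' h1 h2 h
      cases u' with
      | nil => simp at h h1; exact absurd h.1.symm h1.1
      | cons x u' =>
        simp only [List.cons_append, List.cons.injEq, List.mem_cons, not_or] at h h1 h2
        obtain ⟨e1, e2⟩ := ih u' v v' h1.2 h2.2 h.2
        exact ⟨by rw [h.1, e1], e2⟩
  obtain ⟨e1, e2⟩ := key _ _ _ _ hc.sep_notMem hc'.sep_notMem (ha.symm.trans ha')
  subst e1
  obtain ⟨rfl, rfl⟩ := hc.functional hc'
  rw [hq, hq', List.map_injective_iff.2 Letter.ofBit_injective e2]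

theorem IsDyadicCode.padTo {a : List Letter} {q : ℚ} (h : IsDyadicCode a q) (L : ℕ) :
    IsDyadicCode (padTo L a) q := by
  obtain ⟨c, s, m, w, hc, ha, hq⟩ := h
  refine ⟨c, s, m, w ++ List.replicate (L - a.length) false, hc, ?_, ?_⟩
  · rw [_root_.padTo]
    conv_lhs => rw [ha]
    subst ha
    simp [Letter.ofBit]
  · rw [hq, binaryValue_append_zeros]
    simp only [List.length_append, List.length_replicate, pow_add]
    push_cast
    rw [mul_div_mul_right _ _ (by positivity)]

theorem interleave_injective {u v w u' v' w' : List Letter} (hv : u.length = v.length)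
    (hw : u.length = w.length) (hv' : u'.length = v'.length) (hw' : u'.length = w'.length)
    (h : interleave u v w = interleave u' v' w') : v = v' ∧ w = w' := by
  induction u generalizing v w u' v' w' with
  | nil =>
    obtain rfl : v = [] := List.length_eq_zero_iff.1 hv.symm
    obtain rfl : w = [] := List.length_eq_zero_iff.1 hw.symm
    match u', v', w' with
    | [], v', w' =>
      exact ⟨(List.length_eq_zero_iff.1 hv'.symm).symm, (List.length_eq_zero_iff.1 hw'.symm).symm⟩
    | x :: u', y :: v', z :: w' => simp [interleave] at h
    | x :: u', [], w' => simp at hv'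
    | x :: u', y :: v', [] => simp at hw'
  | cons x u ih =>
    match v, w with
    | [], w => simp at hv
    | y :: v, [] => simp at hw
    | y :: v, z :: w =>
      match u', v', w' with
      | [], v', w' => simp [interleave] at h
      | x :: u', [], w' => simp at hv'
      | x :: u', y :: v', [] => simp at hw'
      | x' :: u', y' :: v', z' :: w' =>
        simp only [interleave, List.cons.injEq] at h
        simp only [List.length_cons, Nat.add_right_cancel_iff] at hv hw hv' hw'
        obtain ⟨e1, e2⟩ := ih hv hw hv' hw' h.2.2.2
        exact ⟨by rw [h.2.1, e1], by rw [h.2.2.1, e2]⟩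

theorem length_padTo {L : ℕ} {a : List Letter} (h : a.length ≤ L) : (padTo L a).length = L := by
  simp [padTo]; omega

theorem pairString_ne_nil (a b : List Letter) : pairString a b ≠ [] := by
  have h : ∀ u v w : List Letter, u ≠ [] → v ≠ [] → w ≠ [] → interleave u v w ≠ [] := by
    intro u v w hu hv hw
    match u, v, w, hu, hv, hw with
    | _ :: _, _ :: _, _ :: _, _, _, _ => simp [interleave]
  have h2 : ∀ L c, c.length ≤ L → 0 < L → padTo L c ≠ [] := by
    intro L c h1 h2 h3
    have := length_padTo h1
    rw [h3] at this
    simp at this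
    omega
  apply h <;> apply h2
  all_goals first | omega | simp

theorem IsIntervalCode.functional {s : List Letter} {I I' : CodedInterval}
    (h : IsIntervalCode s I) (h' : IsIntervalCode s I') : I = I' := by
  generalize hs : s = s' at h'
  cases h with
  | infinite =>
    cases h' with
    | infinite => rfl
    | finite => exact absurd hs.symm (pairString_ne_nil _ _)
  | @finite a b r ε ha hb hε =>
    cases h' with
    | infinite => exact absurd hs (pairString_ne_nil _ _)
    | @finite a' b' r' ε' ha' hb' hε' =>
      rw [pairString, pairString] at hs
      have len : ∀ (a b : List Letter) (x : Letter),
          let L := max (max a.length b.length) (min a.length b.length + 2)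
          (padTo L (List.replicate (min a.length b.length) Letter.one ++
            [Letter.zero, x])).length = L ∧
          (padTo L a).length = L ∧ (padTo L b).length = L := by
        intro a b x
        refine ⟨length_padTo ?_, length_padTo ?_, length_padTo ?_⟩
        · simp
        · simp
        · simp
      obtain ⟨l1, l2, l3⟩ := len a b (Letter.ofBit (decide (a.length < b.length)))
      obtain ⟨l1', l2', l3'⟩ := len a' b' (Letter.ofBit (decide (a'.length < b'.length)))
      obtain ⟨e1, e2⟩ := interleave_injective (l1.trans l2.symm) (l1.trans l3.symm)
        (l1'.trans l2'.symm) (l1'.trans l3'.symm) hs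
      rw [(ha.padTo _).functional (e1 ▸ ha'.padTo _), (hb.padTo _).functional (e2 ▸ hb'.padTo _)]

theorem EncodesIntervals.functional {ψ : StringFun} {I I' : ℕ → CodedInterval}
    (h : EncodesIntervals ψ I) (h' : EncodesIntervals ψ I') : I = I' :=
  funext fun n => (h n _ (isIntCode_two_pow n)).functional (h' n _ (isIntCode_two_pow n))

theorem IsIntervalName.functional {ψ : StringFun} {x y : ℝ}
    (h : IsIntervalName ψ x) (h' : IsIntervalName ψ y) : x = y := by
  obtain ⟨I, hI, -, hx⟩ := h
  obtain ⟨J, hJ, -, hy⟩ := h'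
  rw [hI.functional hJ] at hx
  exact Set.singleton_injective (hx.symm.trans hy)

theorem mem_intervalRep {ψ : StringFun} {x : ℝ} : x ∈ intervalRep ψ ↔ IsIntervalName ψ x :=
  ⟨fun ⟨h, e⟩ => e ▸ h.choose_spec, fun h => ⟨⟨x, h⟩, (Exists.choose_spec ⟨x, h⟩ :
    IsIntervalName ψ _).functional h⟩⟩

theorem exists_binaryValue_eq (m : ℕ) : m = 0 ∨ ∃ w, binaryValue (true :: w) = m := by
  induction m using Nat.strong_induction_on with
  | _ m ih =>
    rcases Nat.eq_zero_or_pos m with h0 | h0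
    · exact .inl h0
    right
    rcases ih (m / 2) (by omega) with h | ⟨w, hw⟩
    · exact ⟨[], by simp [binaryValue]; omega⟩
    · refine ⟨w ++ [decide (m % 2 = 1)], ?_⟩
      rw [← List.cons_append, binaryValue_append, hw]
      rcases Nat.mod_two_eq_zero_or_one m with h | h <;> simp [h] <;> omega

theorem exists_binaryValue_eq_of_lt (n j : ℕ) (h : j < 2 ^ n) :
    ∃ w, w.length = n ∧ binaryValue w = j := by
  induction n generalizing j with
  | zero => exact ⟨[], rfl, by simp [binaryValue] at *; omega⟩
  | succ n ih =>
    obtain ⟨w, hl, hw⟩ := ih (j / 2) (by rw [pow_succ] at h; omega)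
    refine ⟨w ++ [decide (j % 2 = 1)], by simp [hl], ?_⟩
    rw [binaryValue_append, hw]
    rcases Nat.mod_two_eq_zero_or_one j with h | h <;> simp [h] <;> omega

theorem exists_isDyadicCode (k : ℤ) (n : ℕ) : ∃ a, IsDyadicCode a ((k : ℚ) / 2 ^ n) := by
  set j := k.natAbs with hj
  have hcode : ∀ s, ∃ c, ∃ s', SignedCode c s' (j / 2 ^ n) ∧ s' = s := by
    intro s
    rcases exists_binaryValue_eq (j / 2 ^ n) with h | ⟨w, hw⟩
    · exact ⟨_, _, h ▸ SignedCode.sign s, rfl⟩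
    · exact ⟨_, _, hw ▸ SignedCode.digits s w, rfl⟩
  obtain ⟨c, s, hc, hs⟩ := hcode (decide (k < 0))
  obtain ⟨w, hl, hw⟩ := exists_binaryValue_eq_of_lt n (j % 2 ^ n) (Nat.mod_lt _ (by positivity))
  refine ⟨_, c, s, _, w, hc, rfl, ?_⟩
  have h1 : (j : ℚ) = 2 ^ n * (j / 2 ^ n : ℕ) + (j % 2 ^ n : ℕ) := by
    exact_mod_cast (Nat.div_add_mod j (2 ^ n)).symm
  have h2 : ((j / 2 ^ n : ℕ) : ℚ) + (j % 2 ^ n : ℕ) / 2 ^ n = j / 2 ^ n := by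
    rw [h1]; field_simp
  rw [hw, hl, h2, hs]
  have h3 : (k : ℚ) = (if decide (k < 0) then -1 else 1) * (j : ℚ) := by
    by_cases hk : k < 0
    · have : (k : ℤ) = -(j : ℤ) := by omega
      simp only [hk, decide_true, if_true]
      rw [this]; push_cast; ring
    · have : (k : ℤ) = (j : ℤ) := by omega
      simp only [hk, decide_false]
      rw [this]; push_cast; simp
  rw [h3, mul_div_assoc]

theorem exists_isIntervalName (x : ℝ) : ∃ ψ, IsIntervalName ψ x := by
  have hcode : ∀ n : ℕ, ∃ s, IsIntervalCode s
      (.finite (((2 * ⌊x * 2 ^ n⌋ + 1 : ℤ) : ℚ) / 2 ^ (n + 1)) (((1 : ℤ) : ℚ) / 2 ^ (n + 1))) := by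
    intro n
    obtain ⟨a, ha⟩ := exists_isDyadicCode (2 * ⌊x * 2 ^ n⌋ + 1) (n + 1)
    obtain ⟨b, hb⟩ := exists_isDyadicCode 1 (n + 1)
    exact ⟨_, .finite ha hb (by positivity)⟩
  choose s hs using hcode
  have hset : ∀ n : ℕ, (CodedInterval.finite (((2 * ⌊x * 2 ^ n⌋ + 1 : ℤ) : ℚ) / 2 ^ (n + 1))
      (((1 : ℤ) : ℚ) / 2 ^ (n + 1))).toSet =
      Set.Icc ((⌊x * 2 ^ n⌋ : ℝ) / 2 ^ n) ((⌊x * 2 ^ n⌋ + 1 : ℝ) / 2 ^ n) := by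
    intro n
    simp only [CodedInterval.toSet]
    congr 1 <;> push_cast <;> rw [pow_succ] <;> field_simp <;> ring
  have hmem : ∀ n : ℕ, (⌊x * 2 ^ n⌋ : ℝ) / 2 ^ n ≤ x ∧ x ≤ (⌊x * 2 ^ n⌋ + 1 : ℝ) / 2 ^ n := by
    intro n
    have hp : (0 : ℝ) < 2 ^ n := by positivity
    exact ⟨(div_le_iff₀ hp).2 (Int.floor_le _), (le_div_iff₀ hp).2 (Int.lt_floor_add_one _).le⟩
  refine ⟨fun a => s (a.length - 2), fun n => .finite (((2 * ⌊x * 2 ^ n⌋ + 1 : ℤ) : ℚ) / 2 ^ (n + 1))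
      (((1 : ℤ) : ℚ) / 2 ^ (n + 1)), fun n a ha => ?_, fun n => ?_, ?_⟩
  · simpa only [ha.length_eq, Nat.add_sub_cancel] using hs n
  · simp only [hset]
    have e : x * 2 ^ (n + 1) = 2 * (x * 2 ^ n) := by ring
    have h1 := Int.floor_le (x * 2 ^ n)
    have h2 := Int.lt_floor_add_one (x * 2 ^ n)
    have h3 : 2 * ⌊x * 2 ^ n⌋ ≤ ⌊x * 2 ^ (n + 1)⌋ := by
      rw [Int.le_floor, e]; push_cast; linarith
    have h4 : ⌊x * 2 ^ (n + 1)⌋ < 2 * ⌊x * 2 ^ n⌋ + 2 := by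
      rw [Int.floor_lt, e]; push_cast; linarith
    have h3' : (2 * ⌊x * 2 ^ n⌋ : ℝ) ≤ ⌊x * 2 ^ (n + 1)⌋ := by exact_mod_cast h3
    have h4' : (⌊x * 2 ^ (n + 1)⌋ : ℝ) + 1 ≤ 2 * ⌊x * 2 ^ n⌋ + 2 := by
      exact_mod_cast (by omega : ⌊x * 2 ^ (n + 1)⌋ + 1 ≤ 2 * ⌊x * 2 ^ n⌋ + 2)
    clear h3 h4 h1 h2
    generalize ⌊x * 2 ^ (n + 1)⌋ = k at *
    apply Set.Icc_subset_Icc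
    · rw [pow_succ, div_le_div_iff₀ (by positivity) (by positivity)]
      have hp : (0 : ℝ) < 2 ^ n := by positivity
      nlinarith
    · rw [pow_succ, div_le_div_iff₀ (by positivity) (by positivity)]
      have hp : (0 : ℝ) < 2 ^ n := by positivity
      nlinarith
  · ext y
    simp only [hset, Set.mem_iInter, Set.mem_Icc, Set.mem_singleton_iff]
    constructor
    · intro hy
      by_contra hne
      have hpos : 0 < |y - x| := abs_pos.2 (sub_ne_zero.2 hne)
      obtain ⟨n, hn⟩ := exists_pow_lt_of_lt_one hpos (by norm_num : (1 / 2 : ℝ) < 1)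
      have h1 := hy n
      have h2 := hmem n
      have h3 : (⌊x * 2 ^ n⌋ + 1 : ℝ) / 2 ^ n = (⌊x * 2 ^ n⌋ : ℝ) / 2 ^ n + (1 / 2) ^ n := by
        rw [add_div, one_div_pow]
      have : |y - x| ≤ (1 / 2) ^ n := by
        rw [abs_le]; constructor <;> linarith [h1.1, h1.2, h2.1, h2.2]
      linarith
    · rintro rfl
      exact hmem

theorem IsIntervalName.exists_diam_le {I : ℕ → CodedInterval} {x : ℝ}
    (hnest : ∀ n, (I (n + 1)).toSet ⊆ (I n).toSet) (hx : ⋂ n, (I n).toSet = {x}) {δ : ℚ}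
    (hδ : 0 < δ) : ∃ N, (I N).diam ≤ (δ : WithTop ℚ) := by
  by_contra! hcon
  have hanti : Antitone fun n => (I n).toSet := antitone_nat_of_succ_le hnest
  have hmem : ∀ n, x ∈ (I n).toSet := fun n =>
    Set.mem_iInter.1 (hx ▸ Set.mem_singleton x : x ∈ ⋂ n, (I n).toSet) n
  have hδ' : (0 : ℝ) < δ := by exact_mod_cast hδ
  have hor : ∀ n, x + δ / 2 ∈ (I n).toSet ∨ x - δ / 2 ∈ (I n).toSet := by
    intro n
    have h1 := hmem n
    have h2 := hcon n
    cases hI : I n with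
    | infinite => left; simp [CodedInterval.toSet]
    | finite r ε =>
      rw [hI] at h1 h2
      simp only [CodedInterval.toSet, CodedInterval.diam, Set.mem_Icc] at h1 h2 ⊢
      have h3 : (δ : ℝ) < 2 * ε := by exact_mod_cast (WithTop.coe_lt_coe.1 h2)
      by_cases h4 : x + δ / 2 ≤ r + ε
      · left; constructor <;> linarith
      · right; constructor <;> linarith
  have hall : (∀ n, x + δ / 2 ∈ (I n).toSet) ∨ (∀ n, x - δ / 2 ∈ (I n).toSet) := by
    by_contra! h
    obtain ⟨⟨n, hn⟩, m, hm⟩ := h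
    rcases hor (max n m) with h | h
    · exact hn (hanti (le_max_left n m) h)
    · exact hm (hanti (le_max_right n m) h)
  rcases hall with h | h
  · have := hx ▸ Set.mem_iInter.2 h
    simp at this; exact hδ.ne' this
  · have := hx ▸ Set.mem_iInter.2 h
    simp at this; exact hδ.ne' this

theorem intervalParam_mono (ψ : StringFun) (h : (intervalRep ψ).Dom) (n : ℕ) :
    intervalParam ψ n ≤ intervalParam ψ (n + 1) := by
  obtain ⟨x, I, hI, hnest, hx⟩ := h
  refine Nat.add_le_add_right (csInf_le_csInf ⟨0, fun _ _ => Nat.zero_le _⟩ ?_ ?_) _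
  · obtain ⟨N, hN⟩ := IsIntervalName.exists_diam_le hnest hx
      (by positivity : (0 : ℚ) < ((2 : ℚ) ^ (n + 1))⁻¹)
    exact ⟨N, I, hI, hN⟩
  · rintro N ⟨J, hJ, hN⟩
    refine ⟨J, hJ, hN.trans (WithTop.coe_le_coe.2 ?_)⟩
    gcongr
    · norm_num
    · omega

/-- The preparametrised space of interval reals. -/
noncomputable def intervalReals : PreparametrisedSpace ℝ where
  rep := intervalRep
  rep_surjective x := (exists_isIntervalName x).imp fun _ h => mem_intervalRep.2 h
  param := intervalParam
  param_mono := intervalParam_mono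

/-!
The machine that computes `f` in linear time uses the length of its input only as a clock. It runs
the given machine `N` on codes of `1, 2, 4, …` for as long as the clock permits and returns the
result of the last run that was completed, or the empty string, the code of `[-∞, ∞]`, if there is
none. To start each run on clean tapes without paying for erasing them, it records every step of a
run on a history tape and then undoes the run step by step, as in Bennett's reversible simulation.
It returns the sequence of intervals that `N` returns, delayed by the running times of `N`. As these
are bounded by a second-order polynomial, the delay, and with it the parameter, grows only by a
second-order polynomial.
-/

/-! ### Bounded reachability -/

/-- `y` is reached from `x` by at most `n` applications of `f`. -/
def ReachesWithin {α : Type*} (f : α → α) (n : ℕ) (x y : α) : Prop :=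
  ∃ s ≤ n, f^[s] x = y

namespace ReachesWithin

variable {α β : Type*} {f : α → α} {g : β → β} {m n : ℕ} {x y z : α}

theorem refl (f : α → α) (x : α) : ReachesWithin f 0 x x :=
  ⟨0, le_rfl, rfl⟩

theorem single (h : f x = y) : ReachesWithin f 1 x y :=
  ⟨1, le_rfl, h⟩

theorem mono (h : ReachesWithin f m x y) (hmn : m ≤ n) : ReachesWithin f n x y :=
  let ⟨s, hs, e⟩ := h
  ⟨s, hs.trans hmn, e⟩

theorem trans (hxy : ReachesWithin f m x y) (hyz : ReachesWithin f n y z) :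
    ReachesWithin f (m + n) x z := by
  obtain ⟨s, hs, rfl⟩ := hxy
  obtain ⟨t, ht, rfl⟩ := hyz
  exact ⟨t + s, by omega, Function.iterate_add_apply f t s x⟩

theorem map {e : α → β} (he : Function.Semiconj e f g) (h : ReachesWithin f n x y) :
    ReachesWithin g n (e x) (e y) := by
  obtain ⟨s, hs, rfl⟩ := h
  exact ⟨s, hs, (he.iterate_right s x).symm⟩

end ReachesWithin

/-! ### Halting, time and output -/

namespace OracleMachine

variable {M : OracleMachine} {φ : StringFun} {a : List Letter} {m n : ℕ}

theorem step_of_halt {c : M.Config} (h : c.state = M.halt) : M.step φ c = c :=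
  if_pos h

theorem iterate_step_of_halt {c : M.Config} (h : c.state = M.halt) (n : ℕ) :
    (M.step φ)^[n] c = c :=
  Function.iterate_fixed (step_of_halt h) n

theorem HaltsAfter.run_eq (h : M.HaltsAfter φ a m) (hmn : m ≤ n) :
    M.run φ a n = M.run φ a m := by
  obtain ⟨d, rfl⟩ := Nat.exists_eq_add_of_le' hmn
  rw [run, Function.iterate_add_apply]
  exact iterate_step_of_halt h d

theorem HaltsAfter.mono (h : M.HaltsAfter φ a m) (hmn : m ≤ n) : M.HaltsAfter φ a n := by
  rw [HaltsAfter, h.run_eq hmn]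
  exact h

theorem time_le_iff : M.time φ a ≤ n ↔ M.HaltsAfter φ a n := by
  refine ⟨fun h => ?_, fun h => iInf₂_le n h⟩
  by_contra hn
  have hlt : ((n + 1 : ℕ) : ℕ∞) ≤ M.time φ a := le_iInf₂ fun m hm =>
    Nat.cast_le.2 (not_le.1 fun hmn => hn (hm.mono hmn))
  exact absurd (Nat.cast_le.1 (hlt.trans h)) n.not_succ_le_self

theorem time_ne_top_iff : M.time φ a ≠ ⊤ ↔ ∃ n, M.HaltsAfter φ a n := by
  simp only [← time_le_iff, ENat.ne_top_iff_exists]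
  exact ⟨fun ⟨n, h⟩ => ⟨n, h.ge⟩, fun ⟨n, h⟩ =>
    ⟨_, ENat.natCast_toNat (ne_top_of_le_ne_top (ENat.natCast_ne_top n) h)⟩⟩

theorem haltsAfter_toNat_time (h : M.time φ a ≠ ⊤) : M.HaltsAfter φ a (M.time φ a).toNat :=
  time_le_iff.1 (ENat.natCast_toNat h).ge

/-- The string on the output tape when `M` halts on input `a` with oracle `φ`. If `M` does not halt,
this is the content of the output tape in the initial configuration, a junk value. -/
noncomputable def output (M : OracleMachine) (φ : StringFun) (a : List Letter) : List Letter :=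
  tapeContent ((M.run φ a (M.time φ a).toNat).tape .output)

theorem HaltsAfter.tapeContent_output (h : M.HaltsAfter φ a n) :
    tapeContent ((M.run φ a n).tape .output) = M.output φ a := by
  have ht : M.time φ a ≤ n := time_le_iff.2 h
  rw [output, (haltsAfter_toNat_time (ne_top_of_le_ne_top (ENat.natCast_ne_top n) ht)).run_eq
    (ENat.toNat_le_of_le_natCast ht)]

theorem time_le_and_output_eq {c : M.Config} (h : ReachesWithin (M.step φ) n (M.init a) c)
    (hc : c.state = M.halt) :
    M.time φ a ≤ n ∧ M.output φ a = tapeContent (c.tape .output) := by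
  obtain ⟨s, hs, rfl⟩ := h
  have hs' : M.HaltsAfter φ a s := hc
  exact ⟨time_le_iff.2 (hs'.mono hs), hs'.tapeContent_output.symm⟩

theorem mem_operator_iff {ψ : StringFun} :
    ψ ∈ M.operator φ ↔ ∀ a, M.time φ a ≠ ⊤ ∧ M.output φ a = ψ a := by
  classical
  have get_eq (h : (M.operator φ).Dom) : (M.operator φ).get h = M.output φ :=
    funext fun a => (Nat.find_spec (h a)).tapeContent_output
  refine ⟨fun ⟨h, e⟩ a => ⟨time_ne_top_iff.2 (h a), by rw [← e, get_eq h]⟩, fun h => ?_⟩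
  have hdom : (M.operator φ).Dom := fun a => time_ne_top_iff.1 (h a).1
  exact ⟨hdom, (get_eq hdom).trans (funext fun a => (h a).2)⟩

end OracleMachine

/-! ### Tapes and heads -/

open Classical in
theorem tapeContent_congr {A B : Type} {S : ℤ → TapeCell A} {T : ℤ → TapeCell B}
    (h : ∀ n : ℕ, (S n).letter = (T n).letter) : tapeContent S = tapeContent T :=
  congrArg (fun u : ℕ → Option Letter =>
    if h : ∃ n, u n = none then (List.range (Nat.find h)).filterMap u else []) (funext h)

theorem tapeContent_blank {A : Type} : tapeContent (fun _ : ℤ => (none : TapeCell A)) = [] := by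
  rw [tapeContent, dif_pos ⟨0, rfl⟩]
  exact List.filterMap_eq_nil_iff.2 fun _ _ => rfl

theorem writtenTape_eq_none_iff {A : Type} {s : List Letter} {n : ℕ} :
    (writtenTape s (n : ℤ) : TapeCell A) = none ↔ s.length ≤ n := by
  change (s[n]?).map Sum.inl = none ↔ _
  rw [Option.map_eq_none_iff, List.getElem?_eq_none_iff]

noncomputable instance {W : Type} : DecidableEq (TapeName W) := Classical.decEq _

/-- The move that undoes a move. -/
def HeadMove.inv : HeadMove → HeadMove
  | .left => .right
  | .stay => .stay
  | .right => .left

theorem HeadMove.toInt_inv (m : HeadMove) : m.inv.toInt = -m.toInt := by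
  cases m <;> rfl

/-- The contents of all tapes of a machine together with the positions of its heads: a configuration
without its state. -/
@[ext]
structure Tapes (W A : Type) where
  tape : TapeName W → ℤ → TapeCell A
  head : TapeName W → ℤ

namespace Tapes

variable {W A : Type} (T : Tapes W A)

/-- The cells under the heads. -/
def scan : TapeName W → TapeCell A := fun t => T.tape t (T.head t)

/-- Write the cells `s` under the heads. -/
def write (s : TapeName W → TapeCell A) : Tapes W A where
  tape t := Function.update (T.tape t) (T.head t) (s t)
  head := T.head

/-- Move all heads. -/
def move (m : TapeName W → HeadMove) : Tapes W A where
  tape := T.tape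
  head t := T.head t + (m t).toInt

/-- Replace the content of the answer tape by the string `s`. -/
noncomputable def putAnswer (s : List Letter) : Tapes W A where
  tape := Function.update T.tape .answer (writtenTape s)
  head := T.head

/-- Translate the tape `t` and its head by `v t` cells. -/
def shift (v : TapeName W → ℤ) : Tapes W A where
  tape t p := T.tape t (p - v t)
  head t := T.head t + v t

theorem write_write (s s' : TapeName W → TapeCell A) : (T.write s).write s' = T.write s' := by
  simp only [write, Function.update_idem]

theorem write_scan : T.write T.scan = T := by
  simp only [write, scan, Function.update_eq_self]

theorem move_move_inv (m : TapeName W → HeadMove) :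
    (T.move m).move (fun t => (m t).inv) = T := by
  simp only [move, HeadMove.toInt_inv, add_neg_cancel_right]

theorem move_stay : T.move (fun _ => .stay) = T := by
  simp only [move, HeadMove.toInt, add_zero]

theorem scan_shift (v : TapeName W → ℤ) : (T.shift v).scan = T.scan :=
  funext fun t => congrArg (T.tape t) (add_sub_cancel_right _ _)

theorem write_shift (v : TapeName W → ℤ) (s : TapeName W → TapeCell A) :
    (T.shift v).write s = (T.write s).shift v := by
  ext t p
  · simp only [write, shift, Function.update_apply, sub_eq_iff_eq_add]
  · rfl

theorem move_shift (v : TapeName W → ℤ) (m : TapeName W → HeadMove) :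
    (T.shift v).move m = (T.move m).shift v := by
  ext t
  · rfl
  · exact add_right_comm _ _ _

/-- The tapes that are blank apart from the content `C` of the input tape, with the heads at `0`
apart from the input head, which is at `p`. -/
noncomputable def ofInput (C : ℤ → TapeCell A) (p : ℤ) : Tapes W A where
  tape := Function.update (fun _ _ => none) .input C
  head := Function.update (fun _ => 0) .input p

theorem ofInput_shift (C : ℤ → TapeCell A) (p v : ℤ) :
    (ofInput C p : Tapes W A).shift (Function.update 0 .input v) =
      ofInput (fun q => C (q - v)) (p + v) := by
  ext t q
  all_goals
    by_cases ht : t = .input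
    · subst ht; simp [shift, ofInput]
    · simp [shift, ofInput, ht]

theorem write_move_ofInput (C : ℤ → TapeCell A) (p : ℤ) (y : TapeCell A) (m : HeadMove) :
    ((ofInput C p : Tapes W A).write (Function.update (ofInput C p).scan .input y)).move
        (Function.update (fun _ => .stay) .input m) =
      ofInput (Function.update C p y) (p + m.toInt) := by
  ext t q
  all_goals
    by_cases ht : t = .input
    · subst ht; simp [write, move, ofInput]
    · simp [write, move, scan, ofInput, ht, HeadMove.toInt]

end Tapes

namespace OracleMachine

variable {M : OracleMachine}

/-- The tapes of a configuration. -/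
def Config.tapes (c : M.Config) : Tapes M.Work M.Aux := ⟨c.tape, c.head⟩

/-- The configuration with state `q` and tapes `T`. -/
def configOf (q : M.State) (T : Tapes M.Work M.Aux) : M.Config := ⟨q, T.tape, T.head⟩

theorem init_eq (a : List Letter) :
    M.init a = configOf M.start (.ofInput (writtenTape a) 0) := by
  have htape : (M.init a).tape = (Tapes.ofInput (writtenTape a) 0).tape := by
    funext t
    by_cases ht : t = .input
    · subst ht; simp [init, Tapes.ofInput]
    · cases t <;> first | exact absurd rfl ht | simp [init, Tapes.ofInput]
  have hhead : (M.init a).head = (Tapes.ofInput (writtenTape (A := M.Aux) a) 0).head := by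
    simp [init, Tapes.ofInput]
  rw [configOf, ← htape, ← hhead]
  rfl

theorem step_ask {φ : StringFun} {c : M.Config} (hask : c.state = M.ask)
    (hhalt : c.state ≠ M.halt) :
    M.step φ c = configOf M.resume (c.tapes.putAnswer (φ (tapeContent (c.tape .query)))) := by
  rw [step, if_neg hhalt, if_pos hask]
  refine congrArg (Config.mk M.resume · c.head) (funext fun t => ?_)
  cases t <;> simp [Tapes.putAnswer, Config.tapes]

theorem step_trans {φ : StringFun} {c : M.Config} (hask : c.state ≠ M.ask)
    (hhalt : c.state ≠ M.halt) :
    M.step φ c = configOf (M.trans c.state c.tapes.scan).1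
      ((c.tapes.write fun t => ((M.trans c.state c.tapes.scan).2 t).1).move
        fun t => ((M.trans c.state c.tapes.scan).2 t).2) := by
  rw [step, if_neg hhalt, if_neg hask]
  rfl

theorem semiconj_shift (φ : StringFun) {v : TapeName M.Work → ℤ} (hquery : v .query = 0)
    (hanswer : v .answer = 0) :
    Function.Semiconj (fun c : M.Config => configOf c.state (c.tapes.shift v))
      (M.step φ) (M.step φ) := by
  intro c
  by_cases hhalt : c.state = M.halt
  · rw [step_of_halt hhalt, step_of_halt (by exact hhalt)]
  by_cases hask : c.state = M.ask
  · rw [step_ask hask hhalt, step_ask (by exact hask) (by exact hhalt)]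
    refine congrArg (Config.mk M.resume · _) (funext fun t => ?_)
    by_cases ht : t = .answer
    · subst ht
      simp [Tapes.putAnswer, Tapes.shift, configOf, Config.tapes, hquery, hanswer]
    · simp [Tapes.putAnswer, Tapes.shift, configOf, Config.tapes, ht]
  · rw [step_trans hask hhalt, step_trans (by exact hask) (by exact hhalt)]
    have hscan : (configOf c.state (c.tapes.shift v)).tapes.scan = c.tapes.scan :=
      c.tapes.scan_shift v
    have htapes (s : TapeName M.Work → TapeCell M.Aux) (m : TapeName M.Work → HeadMove) :
        ((c.tapes.write s).move m).shift v = ((c.tapes.shift v).write s).move m := by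
      rw [Tapes.write_shift, Tapes.move_shift]
    rw [hscan]
    exact congrArg (configOf _) (htapes _ _)

end OracleMachine

/-! ### The clocked machine -/

attribute [instance] OracleMachine.finite_state OracleMachine.finite_aux OracleMachine.finite_work

namespace Clocked

/-- The phases of the clocked machine of a machine with set of states `Q`, where `C` is the set of
families of cells that the heads of that machine can scan. -/
inductive Phase (Q C : Type)
  /-- Simulating the machine in the state `q`. In the `final` run the clock is ignored and the
  output is kept; `post` means that the run has already called the oracle. -/
  | sim (final post : Bool) (q : Q)
  /-- Calling the oracle for the simulated machine. -/
  | ask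
  | resume
  /-- About to undo the topmost recorded step of a run that was completed if `success` holds. -/
  | rewind (success : Bool)
  /-- The heads are back at the cells that the undone step overwrote with the contents `s`. -/
  | restore (success : Bool) (s : C)
  /-- `grow₁`, `grow₂` and `grow₃` replace the simulated input, a code of `2 ^ k`, by one of
  `2 ^ (k + 1)`. -/
  | grow₁
  | grow₂
  | grow₃
  /-- `shrink₁` and `shrink₂` replace the simulated input, a code of `2 ^ (k + 1)`, by one of
  `2 ^ k`. -/
  | shrink₁
  | shrink₂
  | halt
  deriving Fintype

namespace Phase

variable {Q C : Type}

instance [Finite Q] [Finite C] : Finite (Phase Q C) :=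
  have := Fintype.ofFinite Q
  have := Fintype.ofFinite C
  inferInstance

/-- In these phases the history head is on the topmost record, in all others on the blank cell above
it. -/
def rewinding : Phase Q C → Bool
  | rewind _ => true
  | restore _ _ => true
  | _ => false

end Phase

/-- The ways in which one step changes the stack on the history tape. -/
inductive HistoryEdit (R : Type)
  | keep
  | push (r : R)
  | pop

namespace HistoryEdit

variable {R : Type}

/-- The stack after the edit; its top is the head of the list. -/
def apply : HistoryEdit R → List R → List R
  | keep, l => l
  | push r, l => r :: l
  | pop, l => l.tail

/-- The cell that the edit writes when it scans the cell `c`. -/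
def cell {A : Type} : HistoryEdit R → TapeCell (A ⊕ R) → TapeCell (A ⊕ R)
  | keep, c => c
  | push r, _ => some (.inr (.inr r))
  | pop, _ => none

/-- The move of the history head, where `b` and `b'` say whether it is on the topmost record (and
not on the blank cell above it) before and after the step. -/
def headMove (b b' : Bool) : HistoryEdit R → HeadMove
  | keep => if b = b' then .stay else if b then .right else .left
  | push _ => .right
  | pop => .left

/-- The edit of the stack `l` can be carried out in one step, with `b` and `b'` as in `headMove`. -/
def Valid (b b' : Bool) (l : List R) : HistoryEdit R → Prop
  | keep => True
  | push _ => b = false ∧ b' = false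
  | pop => b = true ∧ b' = true ∧ l ≠ []

end HistoryEdit

/-- The history tape that holds the stack `l`, with its bottom in the cell `0`. -/
def historyTape {A R : Type} (l : List R) : ℤ → TapeCell (A ⊕ R)
  | .ofNat i => (l.reverse[i]?).map fun r => .inr (.inr r)
  | .negSucc _ => none

/-- The position of the history head; `b` says that it is on the topmost record. -/
def historyHead {R : Type} (b : Bool) (l : List R) : ℤ := l.length - b.toNat

section History

variable {A R : Type} (r : R) (l : List R)

theorem historyTape_length : (historyTape l l.length : TapeCell (A ⊕ R)) = none := by
  change (l.reverse[l.length]?).map _ = none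
  rw [List.getElem?_eq_none (List.length_reverse).le, Option.map_none]

theorem historyTape_cons : (historyTape (r :: l) : ℤ → TapeCell (A ⊕ R)) =
    Function.update (historyTape l) l.length (some (.inr (.inr r))) := by
  funext p
  rcases p with i | i
  · simp only [historyTape, Function.update_apply, List.reverse_cons, List.getElem?_append,
      List.length_reverse, Int.ofNat_eq_natCast, Nat.cast_inj]
    rcases lt_trichotomy i l.length with hi | rfl | hi
    · simp [hi, hi.ne]
    · simp
    · simp [hi.not_gt, hi.ne', Nat.sub_ne_zero_of_lt hi]
  · rw [Function.update_of_ne (by omega)]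
    rfl

theorem historyTape_top : (historyTape l (historyHead true l) : TapeCell (A ⊕ R)) =
    l.head?.map fun r => .inr (.inr r) := by
  cases l with
  | nil => rfl
  | cons r l =>
    have hhead : historyHead true (r :: l) = l.length := by simp [historyHead]
    rw [hhead, historyTape_cons, Function.update_self]
    rfl

theorem HistoryEdit.Valid.update_historyTape {e : HistoryEdit R} {b b' : Bool} {l : List R}
    (h : e.Valid b b' l) :
    Function.update (historyTape l) (historyHead b l)
        (e.cell (historyTape l (historyHead b l) : TapeCell (A ⊕ R))) =
      historyTape (e.apply l) := by
  cases e with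
  | keep => exact Function.update_eq_self _ _
  | push r =>
    have hhead : historyHead b l = l.length := by simp [historyHead, h.1]
    rw [hhead]
    exact (historyTape_cons r l).symm
  | pop =>
    obtain ⟨rfl, -, hl⟩ := h
    obtain ⟨r, l, rfl⟩ := List.exists_cons_of_ne_nil hl
    have hhead : historyHead true (r :: l) = l.length := by simp [historyHead]
    rw [hhead, historyTape_cons, Function.update_idem]
    exact Function.update_eq_self_iff.2 (historyTape_length l).symm

theorem HistoryEdit.Valid.historyHead_add_headMove {e : HistoryEdit R} {b b' : Bool} {l : List R}
    (h : e.Valid b b' l) :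
    historyHead b l + (e.headMove b b').toInt = historyHead b' (e.apply l) := by
  cases e with
  | keep =>
    cases b <;> cases b' <;>
      simp [historyHead, headMove, apply, HeadMove.toInt, Int.sub_eq_add_neg]
  | push r =>
    obtain ⟨rfl, rfl⟩ := h
    simp [historyHead, headMove, apply, HeadMove.toInt]
  | pop =>
    obtain ⟨rfl, rfl, hl⟩ := h
    obtain ⟨r, l, rfl⟩ := List.exists_cons_of_ne_nil hl
    simp [historyHead, headMove, apply, HeadMove.toInt, Int.sub_eq_add_neg]

end History

variable (N : OracleMachine)

/-- A family of cells, one for each tape of `N`. -/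
abbrev Cells : Type := TapeName N.Work → TapeCell N.Aux

/-- A family of head moves, one for each tape of `N`. -/
abbrev Moves : Type := TapeName N.Work → HeadMove

/-- The record of a step of `N` from which the step can be undone: the cells it overwrote and the
moves it made. -/
abbrev Record : Type := Cells N × Moves N

/-- What the clocked machine sees in one step: whether the clock has expired, the cells of the true
answer tape, of the history and of the simulated tapes. -/
@[ext]
structure View where
  expired : Bool
  answer : TapeCell N.Aux
  top : Option (Record N)
  cells : Cells N

/-- What the clocked machine does in one step: the new phase, whether the clock advances, the cell
written on the true answer tape, the edit of the history, and what happens to the simulated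
tapes. -/
structure Instruction where
  phase : Phase N.State (Cells N)
  tick : Bool
  answer : TapeCell N.Aux
  history : HistoryEdit (Record N)
  write : Cells N
  move : Moves N

namespace View

variable {N} (v : View N)

/-- Change nothing but the phase. -/
def goto (p : Phase N.State (Cells N)) : Instruction N where
  phase := p
  tick := false
  answer := v.answer
  history := .keep
  write := v.cells
  move _ := .stay

/-- Write `y` on the simulated input tape and make the move `m` there. -/
noncomputable def editInput (p : Phase N.State (Cells N)) (y : TapeCell N.Aux) (m : HeadMove) :
    Instruction N :=
  { v.goto p with
    write := Function.update v.cells .input y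
    move := Function.update (fun _ => .stay) .input m }

/-- The cells that the simulated machine sees. The clocked machine keeps two answer tapes with a
common head position: an oracle call overwrites the true one, and cannot be undone; the other one is
a simulated tape like the others, and stands for the answer tape before the first call. -/
noncomputable def simulatedCells (post : Bool) : Cells N :=
  if post then Function.update v.cells .answer v.answer else v.cells

/-- Perform the step `r` of the simulated machine and record it. -/
def perform (final post : Bool) (r : N.State × (TapeName N.Work → TapeCell N.Aux × HeadMove)) :
    Instruction N where
  phase := .sim final post r.1
  tick := true
  answer := (r.2 .answer).1
  history := .push (v.cells, fun t => (r.2 t).2)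
  write t := (r.2 t).1
  move t := (r.2 t).2

end View

variable {N}

open Classical in
/-- The program of the clocked machine. -/
noncomputable def instruction : Phase N.State (Cells N) → View N → Instruction N
  | .sim final post q, v =>
    if v.expired ∧ ¬ final then v.goto (.rewind false)
    else if q = N.halt then { v.goto (if final then .halt else .rewind true) with tick := true }
    else if q = N.ask then v.goto .ask
    else v.perform final post (N.trans q (v.simulatedCells post))
  | .resume, v => { v.goto (.sim v.expired true N.resume) with tick := true }
  | .rewind success, v =>
    match v.top with
    | some (s, m) =>
      { v.goto (.restore success s) with history := .pop, move := fun t => (m t).inv }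
    | none =>
      if success then v.editInput .grow₁ (v.cells .input) .right
      else v.editInput .shrink₁ none .right
  | .restore success s, v => { v.goto (.rewind success) with write := s }
  | .grow₁, v => v.editInput .grow₂ (some (.inl .zero)) .left
  | .grow₂, v => v.editInput .grow₃ (some (.inl .one)) .left
  | .grow₃, v => v.editInput (.sim false false N.start) (some (.inl .zero)) .stay
  | .shrink₁, v => v.editInput .shrink₂ (some (.inl .zero)) .right
  | .shrink₂, v =>
    if v.cells .input = none then v.goto .halt
    else v.editInput (.sim true false N.start) (some (.inl .one)) .left
  | .ask, v | .halt, v => v.goto .halt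

/-- The work tapes that the clocked machine has in addition to those of the simulated machine. -/
inductive ExtraTape
  | input
  | answer
  | history

/-- A family indexed by the tapes of the clocked machine: its input tape, which serves as the clock,
its true answer tape, the history tape, and the simulated tapes. -/
def combine {β W : Type} (clock answer history : β) (sim : TapeName W → β) :
    TapeName (W ⊕ ExtraTape) → β
  | .input => clock
  | .output => sim .output
  | .query => sim .query
  | .answer => answer
  | .work (.inl w) => sim (.work w)
  | .work (.inr .input) => sim .input
  | .work (.inr .answer) => sim .answer
  | .work (.inr .history) => history

/-- The tape of the clocked machine on which a tape is simulated. -/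
def host {W : Type} : TapeName W → TapeName (W ⊕ ExtraTape)
  | .input => .work (.inr .input)
  | .output => .output
  | .query => .query
  | .answer => .work (.inr .answer)
  | .work w => .work (.inl w)

theorem combine_host {β W : Type} (clock answer history : β) (sim : TapeName W → β)
    (t : TapeName W) : combine clock answer history sim (host t) = sim t := by
  cases t <;> rfl

/-- A simulated cell as a cell of the clocked machine. -/
def encodeCell {A R : Type} : TapeCell A → TapeCell (A ⊕ R) :=
  Option.map (Sum.map id .inl)

/-- The inverse of `encodeCell`, with history records read as blanks. -/
def decodeCell {A R : Type} : TapeCell (A ⊕ R) → TapeCell A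
  | some (.inl s) => some (.inl s)
  | some (.inr (.inl x)) => some (.inr x)
  | _ => none

/-- The history record in a cell, if it holds one. -/
def cellRecord {A R : Type} : TapeCell (A ⊕ R) → Option R
  | some (.inr (.inr r)) => some r
  | _ => none

theorem decodeCell_encodeCell {A R : Type} (c : TapeCell A) :
    decodeCell (encodeCell c : TapeCell (A ⊕ R)) = c := by
  rcases c with _ | _ | _ <;> rfl

theorem letter_encodeCell {A R : Type} (c : TapeCell A) :
    (encodeCell c : TapeCell (A ⊕ R)).letter = c.letter := by
  rcases c with _ | _ | _ <;> rfl

theorem encodeCell_writtenTape {A R : Type} (s : List Letter) :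
    (fun p => encodeCell (writtenTape s p)) = (writtenTape s : ℤ → TapeCell (A ⊕ R)) := by
  funext p
  rcases p with i | i
  · exact Option.map_map _ _ _
  · rfl

/-- The view that the clocked machine has when it scans the cells `s`. -/
def readView (s : TapeName (N.Work ⊕ ExtraTape) → TapeCell (N.Aux ⊕ Record N)) : View N where
  expired := (s .input).isNone
  answer := decodeCell (s .answer)
  top := cellRecord (s (.work (.inr .history)))
  cells t := decodeCell (s (host t))

namespace Instruction

variable (e : Instruction N)

/-- The cells that the clocked machine writes when it scans the cells `s`. -/
def hostCells (s : TapeName (N.Work ⊕ ExtraTape) → TapeCell (N.Aux ⊕ Record N)) :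
    TapeName (N.Work ⊕ ExtraTape) → TapeCell (N.Aux ⊕ Record N) :=
  combine (s .input) (encodeCell e.answer) (e.history.cell (s (.work (.inr .history))))
    fun t => encodeCell (e.write t)

/-- The moves of the heads of the clocked machine; `b` says whether its history head is on the
topmost record. -/
def hostMoves (b : Bool) : TapeName (N.Work ⊕ ExtraTape) → HeadMove :=
  combine (if e.tick then .right else .stay) (e.move .answer)
    (e.history.headMove b e.phase.rewinding) e.move

end Instruction

instance : Finite Letter :=
  Finite.of_surjective ![Letter.zero, Letter.one, Letter.sep] fun
    | .zero => ⟨0, rfl⟩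
    | .one => ⟨1, rfl⟩
    | .sep => ⟨2, rfl⟩

instance : Finite HeadMove :=
  Finite.of_surjective ![HeadMove.left, HeadMove.stay, HeadMove.right] fun
    | .left => ⟨0, rfl⟩
    | .stay => ⟨1, rfl⟩
    | .right => ⟨2, rfl⟩

instance : Finite ExtraTape :=
  Finite.of_surjective ![ExtraTape.input, ExtraTape.answer, ExtraTape.history] fun
    | .input => ⟨0, rfl⟩
    | .answer => ⟨1, rfl⟩
    | .history => ⟨2, rfl⟩

instance {W : Type} [Finite W] : Finite (TapeName W) :=
  Finite.of_surjective (Sum.elim ![TapeName.input, .output, .query, .answer] TapeName.work) fun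
    | .input => ⟨.inl 0, rfl⟩
    | .output => ⟨.inl 1, rfl⟩
    | .query => ⟨.inl 2, rfl⟩
    | .answer => ⟨.inl 3, rfl⟩
    | .work w => ⟨.inr w, rfl⟩

instance {A : Type} [Finite A] : Finite (TapeCell A) :=
  inferInstanceAs (Finite (Option (Letter ⊕ A)))

end Clocked

open Clocked in
/-- The clocked machine of `N`. On an input of length `L` it runs `N` on codes of `1, 2, 4, …`,
undoing each run before the next one, until the clock has ticked `L` times; it then repeats the last
completed run and returns the output of that run, or the empty string if no run was completed. -/
noncomputable def OracleMachine.clocked (N : OracleMachine) : OracleMachine where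
  State := Phase N.State (Cells N)
  Aux := N.Aux ⊕ Record N
  Work := N.Work ⊕ ExtraTape
  finite_state := inferInstance
  finite_aux := inferInstance
  finite_work := inferInstance
  start := .grow₂
  ask := .ask
  resume := .resume
  halt := .halt
  trans p s :=
    let e := instruction p (readView s)
    (e.phase, fun t => (e.hostCells s t, e.hostMoves p.rewinding t))

namespace Clocked

variable {N : OracleMachine}

/-- A configuration of the clocked machine on a fixed input, in terms of the machine it simulates:
`clock` counts the ticks so far, `answer` is the content of the true answer tape, and `tapes` are
the simulated tapes. -/
structure Layout (N : OracleMachine) where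
  phase : Phase N.State (Cells N)
  clock : ℕ
  answer : ℤ → TapeCell N.Aux
  history : List (Record N)
  tapes : Tapes N.Work N.Aux

namespace Layout

variable (φ : StringFun) (a : List Letter) (L : Layout N)

/-- What the clocked machine sees on input `a`. -/
def view : View N where
  expired := decide (a.length ≤ L.clock)
  answer := L.answer (L.tapes.head .answer)
  top := if L.phase.rewinding then L.history.head? else none
  cells := L.tapes.scan

/-- Carry out an instruction. -/
noncomputable def apply (e : Instruction N) : Layout N where
  phase := e.phase
  clock := L.clock + e.tick.toNat
  answer := Function.update L.answer (L.tapes.head .answer) e.answer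
  history := e.history.apply L.history
  tapes := (L.tapes.write e.write).move e.move

/-- The next configuration of the clocked machine on input `a` with oracle `φ`. -/
noncomputable def next : Layout N :=
  match L.phase with
  | .halt => L
  | .ask => { L with
      phase := .resume
      answer := writtenTape (φ (tapeContent (L.tapes.tape .query))) }
  | p => L.apply (instruction p (L.view a))

/-- The tapes of the clocked machine on input `a`. -/
def clockedTapes : Tapes (N.Work ⊕ ExtraTape) (N.Aux ⊕ Record N) where
  tape := combine (writtenTape a) (fun p => encodeCell (L.answer p)) (historyTape L.history)
    fun t p => encodeCell (L.tapes.tape t p)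
  head := combine L.clock (L.tapes.head .answer) (historyHead L.phase.rewinding L.history)
    L.tapes.head

/-- The configuration of the clocked machine on input `a`. -/
noncomputable def toConfig : N.clocked.Config :=
  OracleMachine.configOf (M := N.clocked) L.phase (L.clockedTapes a)

theorem next_eq_apply (hask : L.phase ≠ .ask) (hhalt : L.phase ≠ .halt) :
    L.next φ a = L.apply (instruction L.phase (L.view a)) := by
  rw [next]
  split <;> simp_all only [ne_eq, not_true_eq_false]

theorem valid_history :
    (instruction L.phase (L.view a)).history.Valid L.phase.rewinding
      (instruction L.phase (L.view a)).phase.rewinding L.history := by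
  rcases L with ⟨p, clock, answer, history, tapes⟩
  cases p with
  | sim final post q =>
    simp only [instruction]
    split_ifs <;> simp [HistoryEdit.Valid, View.goto, View.perform, Phase.rewinding]
  | rewind success =>
    cases history <;> cases success <;>
      simp [instruction, HistoryEdit.Valid, view, View.goto, View.editInput, Phase.rewinding]
  | shrink₂ =>
    simp only [instruction]
    split_ifs <;> trivial
  | _ => trivial

theorem readView_scan : readView (L.clockedTapes a).scan = L.view a := by
  have hexpired : (writtenTape a (L.clock : ℤ) : TapeCell (N.Aux ⊕ Record N)).isNone =
      decide (a.length ≤ L.clock) := by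
    rw [Bool.eq_iff_iff, decide_eq_true_iff, Option.isNone_iff_eq_none, writtenTape_eq_none_iff]
  have htop : cellRecord (historyTape L.history (historyHead L.phase.rewinding L.history) :
      TapeCell (N.Aux ⊕ Record N)) = if L.phase.rewinding then L.history.head? else none := by
    cases L.phase.rewinding with
    | true => rw [historyTape_top]; cases L.history <;> rfl
    | false =>
      have hhead : historyHead false L.history = L.history.length := by simp [historyHead]
      rw [hhead, historyTape_length]
      rfl
  have hcells (t : TapeName N.Work) :
      decodeCell ((L.clockedTapes a).scan (host t)) = L.tapes.scan t := by
    simp only [Tapes.scan, clockedTapes, combine_host, decodeCell_encodeCell]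
  exact View.ext hexpired (decodeCell_encodeCell _) htop (funext hcells)

theorem clockedTapes_apply {e : Instruction N}
    (he : e.history.Valid L.phase.rewinding e.phase.rewinding L.history) :
    (L.apply e).clockedTapes a =
      ((L.clockedTapes a).write (e.hostCells (L.clockedTapes a).scan)).move
        (e.hostMoves L.phase.rewinding) := by
  have hsim (t : TapeName N.Work) :
      (fun p => encodeCell (Function.update (L.tapes.tape t) (L.tapes.head t) (e.write t) p) :
          ℤ → TapeCell (N.Aux ⊕ Record N)) =
        Function.update (fun p => encodeCell (L.tapes.tape t p)) (L.tapes.head t)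
          (encodeCell (e.write t)) :=
    Function.comp_update _ _ _ _
  ext1
  · funext t
    rcases t with _ | _ | _ | _ | _ | _ | _ | _
    case input => exact (Function.update_eq_self _ _).symm
    case answer =>
      exact Function.comp_update encodeCell L.answer (L.tapes.head .answer) e.answer
    case work.inr.history => exact he.update_historyTape.symm
    all_goals exact hsim _
  · funext t
    rcases t with _ | _ | _ | _ | w | _ | _ | _
    case input =>
      simp only [clockedTapes, apply, Instruction.hostMoves, combine, Tapes.move, Tapes.write]
      cases e.tick <;> simp [HeadMove.toInt]
    case work.inr.history => exact he.historyHead_add_headMove.symm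
    all_goals rfl

theorem clockedTapes_oracle_call (p : Phase N.State (Cells N))
    (hp : p.rewinding = L.phase.rewinding) (s : List Letter) :
    ({ L with phase := p, answer := writtenTape s } : Layout N).clockedTapes a =
      (L.clockedTapes a).putAnswer s := by
  ext1
  · funext t
    rcases t with _ | _ | _ | _ | w | _ | _ | _
    case answer => simp [clockedTapes, combine, Tapes.putAnswer, encodeCell_writtenTape]
    all_goals simp [clockedTapes, combine, Tapes.putAnswer]
  · simp only [clockedTapes, Tapes.putAnswer, hp]

theorem semiconj_toConfig :
    Function.Semiconj (toConfig (N := N) a) (next φ a) (N.clocked.step φ) := by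
  intro L
  by_cases hhalt : L.phase = .halt
  · have hnext : L.next φ a = L := by rw [next, hhalt]
    exact (congrArg (toConfig a) hnext).trans (OracleMachine.step_of_halt hhalt).symm
  by_cases hask : L.phase = .ask
  · have hquery : tapeContent ((L.toConfig a).tape .query) = tapeContent (L.tapes.tape .query) :=
      tapeContent_congr fun _ => letter_encodeCell _
    have hnext : L.next φ a = { L with
        phase := .resume, answer := writtenTape (φ (tapeContent (L.tapes.tape .query))) } := by
      rw [next, hask]
    rw [OracleMachine.step_ask hask hhalt, hquery]
    simp only [hnext]
    exact congrArg (OracleMachine.configOf (M := N.clocked) .resume)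
      (L.clockedTapes_oracle_call a .resume (by rw [hask]; rfl) _)
  · have hnext : (L.next φ a).toConfig a = OracleMachine.configOf (M := N.clocked) _ _ :=
      (congrArg (toConfig a) (L.next_eq_apply φ a hask hhalt)).trans
        (congrArg (OracleMachine.configOf _) (L.clockedTapes_apply a (L.valid_history a)))
    rw [← L.readView_scan a] at hnext
    exact hnext.trans (OracleMachine.step_trans (c := L.toConfig a) hask hhalt).symm

/-- The initial configuration of the clocked machine. -/
noncomputable def init : Layout N where
  phase := .grow₂
  clock := 0
  answer _ := none
  history := []
  tapes := .ofInput (fun _ => none) 0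

theorem toConfig_init : (init : Layout N).toConfig a = N.clocked.init a := by
  have hblank : (init : Layout N).tapes = ⟨fun _ _ => none, fun _ => 0⟩ :=
    Tapes.ext (Function.update_eq_self _ _) (Function.update_eq_self _ _)
  have hhistory : historyTape [] = fun _ => (none : TapeCell (N.Aux ⊕ Record N)) := by
    funext p
    cases p <;> rfl
  have htape : ((init : Layout N).clockedTapes a).tape = (N.clocked.init a).tape := by
    rw [clockedTapes, hblank]
    funext t
    rcases t with _ | _ | _ | _ | _ | _ | _ | _
    case work.inr.history => exact hhistory
    all_goals rfl
  have hhead : ((init : Layout N).clockedTapes a).head = (N.clocked.init a).head := by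
    rw [clockedTapes, hblank]
    funext t
    rcases t with _ | _ | _ | _ | _ | _ | _ | _ <;> rfl
  exact congrArg₂ (OracleMachine.Config.mk (M := N.clocked) Phase.grow₂) htape hhead

end Layout

end Clocked

/-! ### Simulating and undoing a run -/

namespace Clocked

variable {N : OracleMachine}

/-- Undo a recorded step on the tapes that it led to. -/
def undo (T : Tapes N.Work N.Aux) (r : Record N) : Tapes N.Work N.Aux :=
  (T.move fun t => (r.2 t).inv).write r.1

theorem undo_write_move (T : Tapes N.Work N.Aux) (s : Cells N) (m : Moves N) :
    undo ((T.write s).move m) (T.scan, m) = T := by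
  rw [undo, Tapes.move_move_inv, Tapes.write_write, Tapes.write_scan]

namespace Layout

variable {L : Layout N} {φ : StringFun} {a : List Letter}

theorem apply_goto (L : Layout N) (a : List Letter) (p : Phase N.State (Cells N)) :
    L.apply ((L.view a).goto p) = { L with phase := p } := by
  simp only [apply, view, View.goto, HistoryEdit.apply, Function.update_eq_self, Tapes.write_scan,
    Tapes.move_stay, Bool.toNat_false, add_zero]

theorem apply_goto_tick (L : Layout N) (a : List Letter) (p : Phase N.State (Cells N)) :
    L.apply { (L.view a).goto p with tick := true } =
      { L with phase := p, clock := L.clock + 1 } := by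
  simp only [apply, view, View.goto, HistoryEdit.apply, Function.update_eq_self, Tapes.write_scan,
    Tapes.move_stay, Bool.toNat_true]

theorem reaches_rewind (φ : StringFun) (a : List Letter) (success : Bool) (i : ℕ)
    (A : ℤ → TapeCell N.Aux) (h : List (Record N)) (T : Tapes N.Work N.Aux) :
    ReachesWithin (next φ a) (2 * h.length) ⟨.rewind success, i, A, h, T⟩
      ⟨.rewind success, i, A, [], h.foldl undo T⟩ := by
  induction h generalizing T with
  | nil => exact .refl _ _
  | cons r h ih =>
    have hmove : next φ a ⟨.rewind success, i, A, r :: h, T⟩ =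
        ⟨.restore success r.1, i, A, h, T.move fun t => (r.2 t).inv⟩ := by
      simp [next, instruction, view, Phase.rewinding, apply, View.goto, HistoryEdit.apply,
        Tapes.write_scan]
    have hwrite (T' : Tapes N.Work N.Aux) : next φ a ⟨.restore success r.1, i, A, h, T'⟩ =
        ⟨.rewind success, i, A, h, T'.write r.1⟩ := by
      simp [next, instruction, view, apply, View.goto, HistoryEdit.apply, Tapes.move_stay]
    have hundo : ReachesWithin (next φ a) 2 ⟨.rewind success, i, A, r :: h, T⟩
        ⟨.rewind success, i, A, h, undo T r⟩ :=
      (ReachesWithin.single hmove).trans (.single (hwrite _))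
    exact (hundo.trans (ih _)).mono (by simp only [List.length_cons]; omega)

/-- The tapes of the simulated machine; `post` says that it has already called the oracle. -/
noncomputable def simulatedTapes (L : Layout N) (post : Bool) : Tapes N.Work N.Aux :=
  if post then ⟨Function.update L.tapes.tape .answer L.answer, L.tapes.head⟩ else L.tapes

theorem simulatedCells_view (L : Layout N) (a : List Letter) (post : Bool) :
    (L.view a).simulatedCells post = (L.simulatedTapes post).scan := by
  cases post with
  | false => rfl
  | true =>
    funext t
    by_cases ht : t = .answer
    · subst ht; simp [View.simulatedCells, view, simulatedTapes, Tapes.scan]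
    · simp [View.simulatedCells, view, simulatedTapes, Tapes.scan, ht]

theorem simulatedTapes_tape {t : TapeName N.Work} (ht : t ≠ .answer) (L : Layout N) (post : Bool) :
    (L.simulatedTapes post).tape t = L.tapes.tape t := by
  cases post <;> simp [simulatedTapes, ht]

theorem simulatedTapes_apply_perform (L : Layout N) (a : List Letter) (final post : Bool)
    (r : N.State × (TapeName N.Work → TapeCell N.Aux × HeadMove)) :
    (L.apply ((L.view a).perform final post r)).simulatedTapes post =
      ((L.simulatedTapes post).write fun t => (r.2 t).1).move fun t => (r.2 t).2 := by
  cases post with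
  | false => rfl
  | true =>
    ext1
    · funext t
      by_cases ht : t = .answer
      · subst ht; simp [simulatedTapes, apply, View.perform, Tapes.write, Tapes.move]
      · simp [simulatedTapes, apply, View.perform, Tapes.write, Tapes.move, ht]
    · rfl

open Classical in
theorem next_of_phase_eq_sim {final post : Bool} {q : N.State} (h : L.phase = .sim final post q) :
    L.next φ a =
      if a.length ≤ L.clock ∧ ¬ final then { L with phase := .rewind false }
      else if q = N.halt then
        { L with phase := if final then .halt else .rewind true, clock := L.clock + 1 }
      else if q = N.ask then { L with phase := .ask }
      else L.apply ((L.view a).perform final post (N.trans q (L.simulatedTapes post).scan)) := by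
  have hexpired : ((L.view a).expired ∧ ¬ final) = (a.length ≤ L.clock ∧ ¬ final) :=
    congrArg (· ∧ ¬ final) decide_eq_true_eq
  rw [L.next_eq_apply φ a (by simp [h]) (by simp [h]), h, instruction]
  simp only [hexpired, simulatedCells_view]
  split_ifs <;> first | exact L.apply_goto a _ | exact L.apply_goto_tick a _ | rfl

/-- `L` simulates the configuration `c`, which `N` has reached in `n` steps from the tapes `T₀`, in
a run that began when the clock had ticked `i` times. -/
structure Simulates (final : Bool) (i : ℕ) (T₀ : Tapes N.Work N.Aux) (n : ℕ) (c : N.Config)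
    (L : Layout N) : Prop where
  phase_and_tapes : ∃ post, L.phase = .sim final post c.state ∧ L.simulatedTapes post = c.tapes
  clock : L.clock = i + n
  length_history : L.history.length ≤ n
  undone : L.history.foldl undo L.tapes = T₀

namespace Simulates

variable {final : Bool} {i n : ℕ} {T₀ : Tapes N.Work N.Aux} {c : N.Config}

theorem start (final : Bool) (i : ℕ) (A : ℤ → TapeCell N.Aux) (T : Tapes N.Work N.Aux) :
    Simulates final i T 0 (OracleMachine.configOf N.start T)
      ⟨.sim final false N.start, i, A, [], T⟩ where
  phase_and_tapes := ⟨false, rfl, rfl⟩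
  clock := rfl
  length_history := le_rfl
  undone := rfl

theorem exists_next_of_ask (h : Simulates final i T₀ n c L)
    (hfinal : final = decide (a.length ≤ i + n)) (hask : c.state = N.ask)
    (hhalt : c.state ≠ N.halt) :
    ∃ L', ReachesWithin (next φ a) 3 L L' ∧ Simulates final i T₀ (n + 1) (N.step φ c) L' := by
  obtain ⟨post, hphase, htapes⟩ := h.phase_and_tapes
  let s := φ (tapeContent (L.tapes.tape .query))
  have next_sim : L.next φ a = { L with phase := .ask } := by
    rw [next_of_phase_eq_sim hphase, if_neg (by simp [hfinal, h.clock]), if_neg hhalt, if_pos hask]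
  have next_ask : next φ a { L with phase := .ask } =
      { L with phase := .resume, answer := writtenTape s } := rfl
  have next_resume : next φ a { L with phase := .resume, answer := writtenTape s } =
      { L with
        phase := .sim final true N.resume, clock := L.clock + 1, answer := writtenTape s } := by
    rw [hfinal, ← h.clock]
    exact apply_goto_tick _ _ _
  have hstep : N.step φ c = OracleMachine.configOf N.resume (c.tapes.putAnswer s) := by
    simp only [s, OracleMachine.step_ask hask hhalt,
      ← simulatedTapes_tape (t := .query) nofun L post, htapes]
    rfl
  refine ⟨_, ((ReachesWithin.single next_sim).trans (.single next_ask)).trans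
    (.single next_resume), ?_⟩
  rw [hstep]
  refine ⟨⟨true, rfl, ?_⟩, congrArg (· + 1) h.clock, h.length_history.trans n.le_succ, h.undone⟩
  rw [← htapes]
  cases post <;>
    simp [simulatedTapes, Tapes.putAnswer, OracleMachine.configOf, OracleMachine.Config.tapes]

theorem simulates_next_of_ne_ask (h : Simulates final i T₀ n c L)
    (hfinal : final = decide (a.length ≤ i + n)) (hask : c.state ≠ N.ask)
    (hhalt : c.state ≠ N.halt) :
    Simulates final i T₀ (n + 1) (N.step φ c) (L.next φ a) := by
  obtain ⟨post, hphase, htapes⟩ := h.phase_and_tapes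
  have hnext : L.next φ a =
      L.apply ((L.view a).perform final post (N.trans c.state c.tapes.scan)) := by
    rw [next_of_phase_eq_sim hphase, if_neg (by simp [hfinal, h.clock]), if_neg hhalt, if_neg hask,
      htapes]
  rw [hnext, OracleMachine.step_trans hask hhalt]
  refine ⟨⟨post, rfl, ?_⟩, ?_, ?_, ?_⟩
  · rw [simulatedTapes_apply_perform, htapes]
    rfl
  · exact congrArg (· + 1) h.clock
  · exact Nat.succ_le_succ h.length_history
  · refine Eq.trans ?_ h.undone
    exact congrArg (fun T => L.history.foldl undo T) (undo_write_move L.tapes _ _)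

theorem exists_reaches (hfinal : ∀ j < n, final = decide (a.length ≤ i + j))
    (hhalt : ∀ j < n, ((N.step φ)^[j] c).state ≠ N.halt)
    (h : Simulates final i T₀ 0 c L) :
    ∃ L', ReachesWithin (next φ a) (3 * n) L L' ∧ Simulates final i T₀ n ((N.step φ)^[n] c) L' := by
  induction n with
  | zero => exact ⟨L, .refl _ L, h⟩
  | succ n ih =>
    obtain ⟨L₁, hreach₁, hsim₁⟩ := ih (fun j hj => hfinal j (hj.trans n.lt_succ_self))
      (fun j hj => hhalt j (hj.trans n.lt_succ_self))
    have hn := hfinal n n.lt_succ_self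
    have hc := hhalt n n.lt_succ_self
    obtain ⟨L₂, hreach₂, hsim₂⟩ : ∃ L₂, ReachesWithin (next φ a) 3 L₁ L₂ ∧
        Simulates final i T₀ (n + 1) (N.step φ ((N.step φ)^[n] c)) L₂ := by
      by_cases hask : ((N.step φ)^[n] c).state = N.ask
      · exact hsim₁.exists_next_of_ask hn hask hc
      · exact ⟨_, (ReachesWithin.single rfl).mono (by omega),
          hsim₁.simulates_next_of_ne_ask hn hask hc⟩
    rw [Function.iterate_succ_apply']
    exact ⟨L₂, hreach₁.trans hreach₂, hsim₂⟩

end Simulates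

end Layout

end Clocked

/-! ### Codes of powers of two -/

/-- The code `10…0` of `2 ^ k` with its sign bit. -/
def powCode (k : ℕ) : List Letter := .zero :: .one :: List.replicate k .zero

namespace Clocked

/-- The simulated input tape at the start of the run on `powCode k`. The code ends in the cell `0`,
so that it can be replaced by the code of another power of two at its front. -/
def codeTape {A : Type} (k : ℕ) (p : ℤ) : TapeCell A := writtenTape (powCode k) (p + (k + 1))

section CodeTape

variable {A : Type} (k : ℕ)

theorem codeTape_apply (p : ℤ) : (codeTape k p : TapeCell A) =
    if p = -(k + 1) then some (.inl .zero)
    else if p = -k then some (.inl .one)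
    else if -k < p ∧ p ≤ 0 then some (.inl .zero) else none := by
  obtain ⟨n, rfl⟩ : ∃ n, p = n - (k + 1) := ⟨p + (k + 1), (add_sub_cancel_right _ _).symm⟩
  rw [codeTape, sub_add_cancel]
  rcases n with (_ | _ | n) | n
  · rw [if_pos (by simp)]
    rfl
  · rw [if_neg (by simp), if_pos (by simp)]
    rfl
  · rw [if_neg (by simp; omega), if_neg (by simp; omega)]
    change ((powCode k)[n + 2]?).map Sum.inl = _
    simp only [powCode, List.getElem?_cons_succ, List.getElem?_replicate]
    by_cases h : n < k
    · rw [if_pos h, if_pos (by simp; omega)]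
      rfl
    · rw [if_neg h, if_neg (by simp; omega)]
      rfl
  · rw [if_neg (by omega), if_neg (by omega), if_neg (by omega)]
    rfl

theorem update_codeTape_eq_codeTape_succ :
    Function.update (Function.update (Function.update (codeTape k : ℤ → TapeCell A)
      (-k) (some (.inl .zero))) (-(k + 1)) (some (.inl .one)))
      (-(k + 2)) (some (.inl .zero)) = codeTape (k + 1) := by
  funext p
  simp only [Function.update_apply, codeTape_apply]
  push_cast
  split_ifs <;> first | rfl | omega

theorem update_codeTape_succ_eq_codeTape :
    Function.update (Function.update (Function.update (codeTape (k + 1) : ℤ → TapeCell A)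
      (-(k + 2)) none) (-(k + 1)) (some (.inl .zero)))
      (-k) (some (.inl .one)) = codeTape k := by
  funext p
  simp only [Function.update_apply, codeTape_apply]
  push_cast
  split_ifs <;> first | rfl | omega

theorem update_blank_eq_codeTape_zero :
    Function.update (Function.update (fun _ => none : ℤ → TapeCell A) 0 (some (.inl .one)))
      (-1) (some (.inl .zero)) = codeTape 0 := by
  funext p
  simp only [Function.update_apply, codeTape_apply]
  push_cast
  split_ifs <;> first | rfl | omega

end CodeTape

/-- The simulated tapes at the start of the run on `powCode k`. -/
noncomputable def startTapes {W A : Type} (k : ℕ) : Tapes W A := .ofInput (codeTape k) (-(k + 1))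

/-- The translation from the tapes of `N` in its run on `powCode k` to the simulated tapes. -/
noncomputable def codeShift {W : Type} (k : ℕ) : TapeName W → ℤ :=
  Function.update 0 .input (-(k + 1))

variable {N : OracleMachine}

theorem iterate_step_startTapes (φ : StringFun) (k n : ℕ) :
    (N.step φ)^[n] (OracleMachine.configOf N.start (startTapes k)) =
      OracleMachine.configOf (N.run φ (powCode k) n).state
        ((N.run φ (powCode k) n).tapes.shift (codeShift k)) := by
  have hstart : (startTapes k : Tapes N.Work N.Aux) =
      (N.init (powCode k)).tapes.shift (codeShift k) := by
    rw [OracleMachine.init_eq]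
    refine Eq.trans ?_ (Tapes.ofInput_shift _ _ _).symm
    simp only [sub_neg_eq_add, zero_add]
    rfl
  have hsemiconj := (OracleMachine.semiconj_shift (M := N) φ (v := codeShift k)
    (by simp [codeShift]) (by simp [codeShift])).iterate_right n
  rw [hstart]
  exact (hsemiconj (N.init (powCode k))).symm

namespace Layout

variable {a : List Letter}

theorem apply_editInput {L : Layout N} {C C' : ℤ → TapeCell N.Aux} {x x' : ℤ}
    {q : Phase N.State (Cells N)} {y : TapeCell N.Aux} {m : HeadMove}
    (hL : L.tapes = .ofInput C x) (hC : Function.update C x y = C') (hx : x + m.toInt = x') :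
    L.apply ((L.view a).editInput q y m) = { L with phase := q, tapes := .ofInput C' x' } := by
  subst hC hx
  simp only [apply, view, View.editInput, View.goto, HistoryEdit.apply, Function.update_eq_self,
    Bool.toNat_false, add_zero, hL, Tapes.write_move_ofInput]

theorem reaches_startTapes_zero (φ : StringFun) (a : List Letter) :
    ReachesWithin (next φ a) 2 (init : Layout N)
      ⟨.sim false false N.start, 0, fun _ => none, [], startTapes 0⟩ :=
  (ReachesWithin.single (apply_editInput rfl rfl rfl)).trans
    (.single (apply_editInput rfl update_blank_eq_codeTape_zero rfl))

theorem reaches_startTapes_succ (φ : StringFun) (a : List Letter) (i k : ℕ)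
    (A : ℤ → TapeCell N.Aux) :
    ReachesWithin (next φ a) 4 ⟨.rewind true, i, A, [], startTapes k⟩
      ⟨.sim false false N.start, i, A, [], startTapes (k + 1)⟩ := by
  have hkeep : Function.update (codeTape k) (-(k + 1))
      ((startTapes k : Tapes N.Work N.Aux).scan .input) = codeTape k := by
    simp [startTapes, Tapes.scan, Tapes.ofInput]
  have enter : next φ a ⟨.rewind true, i, A, [], startTapes k⟩ =
      ⟨.grow₁, i, A, [], .ofInput (codeTape k) (-k)⟩ :=
    apply_editInput rfl hkeep (by simp [HeadMove.toInt])
  have write₁ : next φ a ⟨.grow₁, i, A, [], .ofInput (codeTape k) (-k)⟩ =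
      ⟨.grow₂, i, A, [], .ofInput _ (-(k + 1))⟩ :=
    apply_editInput rfl rfl (by simp [HeadMove.toInt]; ring)
  have write₂ (C : ℤ → TapeCell N.Aux) : next φ a ⟨.grow₂, i, A, [], .ofInput C (-(k + 1))⟩ =
      ⟨.grow₃, i, A, [], .ofInput _ (-(k + 2))⟩ :=
    apply_editInput rfl rfl (by simp [HeadMove.toInt]; ring)
  have write₃ : next φ a ⟨.grow₃, i, A, [], .ofInput _ (-(k + 2))⟩ =
      ⟨.sim false false N.start, i, A, [], startTapes (k + 1)⟩ :=
    apply_editInput rfl (update_codeTape_eq_codeTape_succ k) (by simp [HeadMove.toInt]; ring)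
  exact (((ReachesWithin.single enter).trans (.single write₁)).trans (.single (write₂ _))).trans
    (.single write₃)

theorem reaches_startTapes_pred (φ : StringFun) (a : List Letter) (i k : ℕ)
    (A : ℤ → TapeCell N.Aux) :
    ReachesWithin (next φ a) 3 ⟨.rewind false, i, A, [], startTapes (k + 1)⟩
      ⟨.sim true false N.start, i, A, [], startTapes k⟩ := by
  have erase : next φ a ⟨.rewind false, i, A, [], startTapes (k + 1)⟩ =
      ⟨.shrink₁, i, A, [], .ofInput (Function.update (codeTape (k + 1)) (-(k + 2)) none)
        (-(k + 1))⟩ :=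
    apply_editInput rfl (by push_cast; ring_nf) (by simp [HeadMove.toInt])
  have write₁ (C : ℤ → TapeCell N.Aux) : next φ a ⟨.shrink₁, i, A, [], .ofInput C (-(k + 1))⟩ =
      ⟨.shrink₂, i, A, [], .ofInput (Function.update C (-(k + 1)) (some (.inl .zero))) (-k)⟩ :=
    apply_editInput rfl rfl (by simp [HeadMove.toInt])
  have write₂ {C : ℤ → TapeCell N.Aux} (hC : C (-k) ≠ none)
      (hC' : Function.update C (-k) (some (.inl .one)) = codeTape k) :
      next φ a ⟨.shrink₂, i, A, [], .ofInput C (-k)⟩ =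
        ⟨.sim true false N.start, i, A, [], startTapes k⟩ := by
    rw [next_eq_apply _ _ _ (by simp) (by simp), instruction,
      if_neg (by simpa [view, Tapes.scan, Tapes.ofInput] using hC)]
    exact apply_editInput rfl hC' (by simp [HeadMove.toInt]; ring)
  refine ((ReachesWithin.single erase).trans (.single (write₁ _))).trans
    (.single (write₂ ?_ (update_codeTape_succ_eq_codeTape k)))
  simp [codeTape_apply]

theorem exists_reaches_halt_of_startTapes_zero (φ : StringFun) (a : List Letter) (i : ℕ)
    (A : ℤ → TapeCell N.Aux) :
    ∃ C x, ReachesWithin (next φ a) 3 ⟨.rewind false, i, A, [], startTapes 0⟩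
      ⟨.halt, i, A, [], .ofInput C x⟩ := by
  have erase : next φ a ⟨.rewind false, i, A, [], startTapes 0⟩ =
      ⟨.shrink₁, i, A, [], .ofInput (Function.update (codeTape 0) (-1) none) 0⟩ :=
    apply_editInput rfl rfl rfl
  have write (C : ℤ → TapeCell N.Aux) : next φ a ⟨.shrink₁, i, A, [], .ofInput C 0⟩ =
      ⟨.shrink₂, i, A, [], .ofInput (Function.update C 0 (some (.inl .zero))) 1⟩ :=
    apply_editInput rfl rfl rfl
  have halt {C : ℤ → TapeCell N.Aux} (hC : C 1 = none) :
      next φ a ⟨.shrink₂, i, A, [], .ofInput C 1⟩ = ⟨.halt, i, A, [], .ofInput C 1⟩ := by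
    rw [next_eq_apply _ _ _ (by simp) (by simp), instruction,
      if_pos (by simpa [view, Tapes.scan, Tapes.ofInput] using hC)]
    exact apply_goto _ a .halt
  refine ⟨_, _, ((ReachesWithin.single erase).trans (.single (write _))).trans
    (.single (halt ?_))⟩
  simp [codeTape_apply]

end Layout

end Clocked

/-! ### The runs of the clocked machine -/

namespace Clocked

variable {N : OracleMachine}

namespace Layout

variable {φ : StringFun} {a : List Letter} {i k n : ℕ} {final : Bool}

/-- The configuration in which the clocked machine starts the run on `powCode k`. -/
noncomputable def runStart (final : Bool) (i k : ℕ) (A : ℤ → TapeCell N.Aux) : Layout N :=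
  ⟨.sim final false N.start, i, A, [], startTapes k⟩

theorem exists_reaches_simulates (A : ℤ → TapeCell N.Aux)
    (hn : (n : ℕ∞) ≤ N.time φ (powCode k))
    (hfinal : ∀ j < n, final = decide (a.length ≤ i + j)) :
    ∃ L, ReachesWithin (next φ a) (3 * n) (runStart final i k A) L ∧
      Simulates final i (startTapes k) n
        (OracleMachine.configOf (N.run φ (powCode k) n).state
          ((N.run φ (powCode k) n).tapes.shift (codeShift k))) L := by
  rw [← iterate_step_startTapes]
  refine Simulates.exists_reaches hfinal (fun j hj hhalt => ?_) (.start final i A _)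
  rw [iterate_step_startTapes] at hhalt
  exact absurd (Nat.cast_le.1 (hn.trans (OracleMachine.time_le_iff.2 hhalt))) hj.not_ge

theorem exists_reaches_next_run (A : ℤ → TapeCell N.Aux)
    (hn : N.time φ (powCode k) = n) (ha : i + (n + 1) ≤ a.length) :
    ∃ A', ReachesWithin (next φ a) (5 * (n + 1)) (runStart false i k A)
      (runStart false (i + (n + 1)) (k + 1) A') := by
  obtain ⟨L, hreach, hsim⟩ := exists_reaches_simulates (final := false) (a := a) (i := i) A hn.ge
    fun j hj => (decide_eq_false (by omega)).symm
  obtain ⟨post, hphase, -⟩ := hsim.phase_and_tapes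
  have hhalt : (N.run φ (powCode k) n).state = N.halt := OracleMachine.time_le_iff.1 hn.le
  have hnext : L.next φ a = ⟨.rewind true, i + (n + 1), L.answer, L.history, L.tapes⟩ := by
    rw [next_of_phase_eq_sim hphase, if_neg (by rw [hsim.clock]; omega), if_pos (by exact hhalt),
      hsim.clock]
    rfl
  have hrewind := reaches_rewind φ a true (i + (n + 1)) L.answer L.history L.tapes
  rw [hsim.undone] at hrewind
  refine ⟨L.answer, (((hreach.trans (.single hnext)).trans hrewind).trans
    (reaches_startTapes_succ φ a _ k _)).mono ?_⟩
  linarith [hsim.length_history]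

theorem exists_reaches_timeout (A : ℤ → TapeCell N.Aux) (hn : (n : ℕ∞) ≤ N.time φ (powCode k))
    (ha : a.length = i + n) :
    ∃ A', ReachesWithin (next φ a) (5 * n + 1) (runStart false i k A)
      ⟨.rewind false, a.length, A', [], startTapes k⟩ := by
  obtain ⟨L, hreach, hsim⟩ := exists_reaches_simulates (final := false) (a := a) (i := i) A hn
    fun j hj => (decide_eq_false (by omega)).symm
  obtain ⟨post, hphase, -⟩ := hsim.phase_and_tapes
  have hnext : L.next φ a = ⟨.rewind false, a.length, L.answer, L.history, L.tapes⟩ := by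
    rw [next_of_phase_eq_sim hphase, if_pos ⟨by rw [hsim.clock, ha], nofun⟩, ha, ← hsim.clock]
  have hrewind := reaches_rewind φ a false a.length L.answer L.history L.tapes
  rw [hsim.undone] at hrewind
  refine ⟨L.answer, ((hreach.trans (.single hnext)).trans hrewind).mono ?_⟩
  linarith [hsim.length_history]

theorem exists_reaches_halt (A : ℤ → TapeCell N.Aux) (hn : N.time φ (powCode k) = n)
    (ha : a.length ≤ i) :
    ∃ L, ReachesWithin (next φ a) (3 * n + 1) (runStart true i k A) L ∧ L.phase = .halt ∧
      tapeContent (L.tapes.tape .output) = N.output φ (powCode k) := by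
  obtain ⟨L, hreach, hsim⟩ := exists_reaches_simulates (final := true) (a := a) (i := i) A hn.ge
    fun _ _ => (decide_eq_true (by omega)).symm
  obtain ⟨post, hphase, htapes⟩ := hsim.phase_and_tapes
  have hhalt : (N.run φ (powCode k) n).state = N.halt := OracleMachine.time_le_iff.1 hn.le
  have hnext : L.next φ a = { L with phase := .halt, clock := L.clock + 1 } := by
    rw [next_of_phase_eq_sim hphase, if_neg (by simp), if_pos (by exact hhalt)]
    rfl
  have houtput : L.tapes.tape .output = (N.run φ (powCode k) n).tape .output := by
    rw [← simulatedTapes_tape (t := .output) nofun L post, htapes]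
    simp [OracleMachine.configOf, OracleMachine.Config.tapes, Tapes.shift, codeShift]
  refine ⟨_, hreach.trans (.single hnext), rfl, ?_⟩
  rw [houtput, OracleMachine.HaltsAfter.tapeContent_output hhalt]

end Layout

end Clocked

/-! ### The schedule of the clocked machine -/

/-- The sequence `x, s 0, s 1, …`. -/
def delay {α : Type*} (x : α) (s : ℕ → α) : ℕ → α
  | 0 => x
  | k + 1 => s k

namespace Clocked

variable (N : OracleMachine) (φ : StringFun)

/-- The number of clock ticks that the clocked machine needs for its first `k` runs: each takes one
tick per step of `N` and one for noticing that `N` has halted. -/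
noncomputable def totalTime (k : ℕ) : ℕ∞ := ∑ j ∈ Finset.range k, (N.time φ (powCode j) + 1)

open Classical in
/-- The number of runs that the clocked machine completes before its clock has ticked `n` times. -/
noncomputable def completedRuns (n : ℕ) : ℕ := Nat.findGreatest (fun k => totalTime N φ k ≤ n) n

theorem totalTime_succ (k : ℕ) :
    totalTime N φ (k + 1) = totalTime N φ k + (N.time φ (powCode k) + 1) :=
  Finset.sum_range_succ _ _

theorem totalTime_mono : Monotone (totalTime N φ) :=
  monotone_nat_of_le_succ fun k => (totalTime_succ N φ k).ge.trans' le_self_add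

theorem le_totalTime (k : ℕ) : (k : ℕ∞) ≤ totalTime N φ k := by
  induction k with
  | zero => exact zero_le
  | succ k ih =>
    rw [totalTime_succ, Nat.cast_succ]
    exact add_le_add ih le_add_self

variable {N φ}

theorem le_completedRuns_iff {k n : ℕ} : k ≤ completedRuns N φ n ↔ totalTime N φ k ≤ n := by
  refine ⟨fun h => (totalTime_mono N φ h).trans ?_, fun h => ?_⟩
  · exact Nat.findGreatest_spec (P := fun k => totalTime N φ k ≤ n) n.zero_le
      (by simp [totalTime])
  · exact Nat.le_findGreatest (Nat.cast_le.1 ((le_totalTime N φ k).trans h)) h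

theorem completedRuns_mono : Monotone (completedRuns N φ) := fun _ _ h =>
  le_completedRuns_iff.2 ((le_completedRuns_iff.1 le_rfl).trans (Nat.cast_le.2 h))

namespace Layout

variable {a : List Letter} {i k : ℕ}

theorem exists_reaches_runStart (h : totalTime N φ k = i) (ha : i ≤ a.length) :
    ∃ A, ReachesWithin (next φ a) (5 * i + 2) init (runStart (N := N) false i k A) := by
  induction k generalizing i with
  | zero =>
    obtain rfl : i = 0 := Nat.cast_eq_zero.1 (h.symm.trans (Finset.sum_range_zero _))
    exact ⟨_, reaches_startTapes_zero φ a⟩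
  | succ k ih =>
    rw [totalTime_succ] at h
    obtain ⟨htotal, htime⟩ : totalTime N φ k ≠ ⊤ ∧ N.time φ (powCode k) ≠ ⊤ := by
      have hfinite := h ▸ ENat.natCast_ne_top i
      simpa only [ne_eq, ENat.add_eq_top, not_or, ENat.one_ne_top, not_false_eq_true, and_true]
        using hfinite
    obtain ⟨m, hm⟩ := ENat.ne_top_iff_exists.1 htotal
    obtain ⟨n, hn⟩ := ENat.ne_top_iff_exists.1 htime
    obtain rfl : i = m + (n + 1) := by
      rw [← hm, ← hn] at h
      exact_mod_cast h.symm
    obtain ⟨A, hreach⟩ := ih hm.symm (by omega)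
    obtain ⟨A', hreach'⟩ := exists_reaches_next_run A hn.symm ha
    exact ⟨A', (hreach.trans hreach').mono (by omega)⟩

theorem exists_reaches_last_run (φ : StringFun) (a : List Letter) :
    ∃ A, ReachesWithin (next φ a) (5 * a.length + 3) init
      (⟨.rewind false, a.length, A, [], startTapes (completedRuns N φ a.length)⟩ : Layout N) := by
  set k := completedRuns N φ a.length
  have hle : totalTime N φ k ≤ a.length := le_completedRuns_iff.1 le_rfl
  have hlt : ¬ totalTime N φ (k + 1) ≤ a.length := fun h =>
    k.not_succ_le_self (le_completedRuns_iff.2 h)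
  obtain ⟨i, hi⟩ := ENat.ne_top_iff_exists.1 (ne_top_of_le_ne_top (ENat.natCast_ne_top _) hle)
  have hia : i ≤ a.length := Nat.cast_le.1 (hi.trans_le hle)
  obtain ⟨n, hn⟩ := Nat.exists_eq_add_of_le hia
  have htime : (n : ℕ∞) ≤ N.time φ (powCode k) := by
    rw [totalTime_succ, ← hi, hn, Nat.cast_add, not_le] at hlt
    exact ENat.natCast_lt_add_one_iff.1 (lt_of_add_lt_add_left hlt)
  obtain ⟨A, hreach⟩ := exists_reaches_runStart hi.symm hia
  obtain ⟨A', hreach'⟩ := exists_reaches_timeout A htime hn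
  exact ⟨A', (hreach.trans hreach').mono (by omega)⟩

theorem exists_reaches_phase_eq_halt (φ : StringFun) (a : List Letter) :
    ∃ L, ReachesWithin (next φ a) (8 * a.length + 8) (init : Layout N) L ∧ L.phase = .halt ∧
      tapeContent (L.tapes.tape .output) =
        delay [] (fun k => N.output φ (powCode k)) (completedRuns N φ a.length) := by
  obtain ⟨A, hreach⟩ := exists_reaches_last_run (N := N) φ a
  have hle : totalTime N φ (completedRuns N φ a.length) ≤ a.length := le_completedRuns_iff.1 le_rfl
  generalize completedRuns N φ a.length = k at hreach hle
  cases k with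
  | zero =>
    obtain ⟨C, x, hreach'⟩ := exists_reaches_halt_of_startTapes_zero (N := N) φ a a.length A
    refine ⟨_, (hreach.trans hreach').mono (by omega), rfl, ?_⟩
    have hblank : (Tapes.ofInput C x : Tapes N.Work N.Aux).tape .output = fun _ => none := by
      simp [Tapes.ofInput]
    exact (congrArg tapeContent hblank).trans tapeContent_blank
  | succ k =>
    have htime : N.time φ (powCode k) ≤ a.length := by
      rw [totalTime_succ] at hle
      exact (le_self_add.trans le_add_self).trans hle
    obtain ⟨n, hn⟩ := ENat.ne_top_iff_exists.1 (ne_top_of_le_ne_top (ENat.natCast_ne_top _) htime)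
    have hna : n ≤ a.length := Nat.cast_le.1 (hn.trans_le htime)
    obtain ⟨L, hreach', hhalt, houtput⟩ := exists_reaches_halt A hn.symm le_rfl
    have hfinal := (hreach.trans (reaches_startTapes_pred φ a _ k A)).trans hreach'
    exact ⟨L, hfinal.mono (by omega), hhalt, houtput⟩

end Layout

theorem time_clocked_le_and_output_eq (N : OracleMachine) (φ : StringFun) (a : List Letter) :
    N.clocked.time φ a ≤ (8 * a.length + 8 : ℕ) ∧ N.clocked.output φ a =
      delay [] (fun k => N.output φ (powCode k)) (completedRuns N φ a.length) := by
  obtain ⟨L, hreach, hhalt, houtput⟩ := Layout.exists_reaches_phase_eq_halt (N := N) φ a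
  have hreach' := hreach.map (Layout.semiconj_toConfig φ a)
  rw [Layout.toConfig_init] at hreach'
  obtain ⟨htime, hout⟩ := OracleMachine.time_le_and_output_eq hreach' hhalt
  exact ⟨htime, hout.trans ((tapeContent_congr fun _ => letter_encodeCell _).trans houtput)⟩

end Clocked

/-! ### Second-order polynomials -/

namespace IsSecondOrderPolynomial

theorem const (c : ℕ) : IsSecondOrderPolynomial fun _ _ => c := by
  simpa using poly (Polynomial.C c)

theorem monotone {P : (ℕ → ℕ) → ℕ → ℕ} (hP : IsSecondOrderPolynomial P) {l : ℕ → ℕ}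
    (hl : Monotone l) : Monotone (P l) := by
  induction hP with
  | poly p =>
    intro m n hmn
    simp only [Polynomial.eval_eq_sum_range]
    gcongr
  | app _ ih => exact hl.comp ih
  | add _ _ ih₁ ih₂ => exact ih₁.add ih₂
  | mul _ _ ih₁ ih₂ => exact fun m n hmn => Nat.mul_le_mul (ih₁ hmn) (ih₂ hmn)

theorem comp {P Q : (ℕ → ℕ) → ℕ → ℕ} (hP : IsSecondOrderPolynomial P)
    (hQ : IsSecondOrderPolynomial Q) : IsSecondOrderPolynomial fun l n => P l (Q l n) := by
  induction hP with
  | poly p =>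
    induction p using Polynomial.induction_on' with
    | add p q hp hq => simpa only [Polynomial.eval_add] using hp.add hq
    | monomial d c =>
      simp only [Polynomial.eval_monomial]
      refine (const c).mul ?_
      induction d with
      | zero => simpa only [pow_zero] using const 1
      | succ d ih => simpa only [pow_succ] using ih.mul hQ
  | app _ ih => exact ih.app
  | add _ _ ih₁ ih₂ => exact ih₁.add ih₂
  | mul _ _ ih₁ ih₂ => exact ih₁.mul ih₂

end IsSecondOrderPolynomial

/-! ### Delayed interval names -/

theorem CodedInterval.diam_finite_le_of_toSet_subset {r ε : ℚ} {J : CodedInterval} (hε : 0 ≤ ε)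
    (h : (finite r ε).toSet ⊆ J.toSet) : (finite r ε).diam ≤ J.diam := by
  cases J with
  | infinite => exact le_top
  | finite r' ε' =>
    have hε' : (0 : ℝ) ≤ ε := Rat.cast_nonneg.2 hε
    have hbounds := (Set.Icc_subset_Icc_iff (by linarith)).1 h
    refine WithTop.coe_le_coe.2 ?_
    exact_mod_cast (by linarith : (2 * ε : ℝ) ≤ 2 * ε')

theorem IsIntervalCode.diam_le_of_toSet_subset {s : List Letter} {I J : CodedInterval}
    (hI : IsIntervalCode s I) (h : I.toSet ⊆ J.toSet) : I.diam ≤ J.diam := by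
  cases hI with
  | finite _ _ hε => exact CodedInterval.diam_finite_le_of_toSet_subset hε h
  | infinite =>
    cases J with
    | infinite => exact le_rfl
    | finite r ε => exact absurd (bddAbove_Icc.mono h) not_bddAbove_univ

theorem intervalParam_eq {ψ : StringFun} {I : ℕ → CodedInterval} {x : ℝ}
    (hI : EncodesIntervals ψ I) (hx : IsIntervalName ψ x) (n : ℕ) :
    intervalParam ψ n = sInf {N | (I N).diam ≤ (((2 : ℚ) ^ n)⁻¹ : ℚ)} +
      ⌈Real.logb 2 (|x| + 1)⌉₊ := by
  have hindex : {N | ∃ J, EncodesIntervals ψ J ∧ (J N).diam ≤ (((2 : ℚ) ^ n)⁻¹ : ℚ)} =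
      {N | (I N).diam ≤ (((2 : ℚ) ^ n)⁻¹ : ℚ)} := by
    ext N
    exact ⟨fun ⟨J, hJ, h⟩ => hI.functional hJ ▸ h, fun h => ⟨I, hI, h⟩⟩
  have hmem := mem_intervalRep.2 hx
  rw [intervalParam, hindex, Part.getOrElse, dif_pos hmem.fst, Part.get_eq_of_mem hmem]

/-- The string function that answers a query of length `n` with the value of `ψ` at the code of
`2 ^ (κ n - 1)`, and with the empty string, the code of `[-∞, ∞]`, if `κ n = 0`. -/
def delayedName (ψ : StringFun) (κ : ℕ → ℕ) : StringFun := fun a =>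
  delay [] (fun k => ψ (powCode k)) (κ a.length)

section DelayedName

open Filter

variable {ψ : StringFun} {κ : ℕ → ℕ} {I : ℕ → CodedInterval} {x : ℝ}

theorem EncodesIntervals.delayedName (hI : EncodesIntervals ψ I) :
    EncodesIntervals (delayedName ψ κ) fun n => delay .infinite I (κ (n + 2)) := by
  intro n a ha
  change IsIntervalCode (delay [] _ (κ a.length)) (delay .infinite I (κ (n + 2)))
  rw [ha.length_eq]
  cases κ (n + 2) with
  | zero => exact .infinite
  | succ k => exact hI k _ (isIntCode_two_pow k)

theorem antitone_toSet_delay_infinite (hnest : ∀ n, (I (n + 1)).toSet ⊆ (I n).toSet) :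
    Antitone fun k => (delay .infinite I k).toSet := by
  refine antitone_nat_of_succ_le fun k => ?_
  cases k with
  | zero => exact Set.subset_univ _
  | succ k => exact hnest k

theorem IsIntervalName.delayedName (hψ : IsIntervalName ψ x) (hκ : Monotone κ)
    (hκ' : Tendsto κ atTop atTop) : IsIntervalName (delayedName ψ κ) x := by
  obtain ⟨I, hI, hnest, hx⟩ := hψ
  have hanti := antitone_toSet_delay_infinite hnest
  refine ⟨_, hI.delayedName, fun n => hanti (hκ (by omega)), ?_⟩
  have hlim : Tendsto (fun n => κ (n + 2)) atTop atTop := hκ'.comp (tendsto_add_atTop_nat 2)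
  rw [← hx]
  refine subset_antisymm (Set.subset_iInter fun k => ?_) (Set.subset_iInter fun n => ?_)
  · obtain ⟨n, hn⟩ := (hlim.eventually_ge_atTop (k + 1)).exists
    exact (Set.iInter_subset _ n).trans (hanti hn)
  · cases κ (n + 2) with
    | zero => exact Set.subset_univ _
    | succ k => exact Set.iInter_subset _ k

theorem intervalParam_delayedName_le (hψ : IsIntervalName ψ x) (hκ : Monotone κ)
    (hκ' : Tendsto κ atTop atTop) {m n : ℕ} (h : intervalParam ψ n + 1 ≤ κ (m + 2)) :
    intervalParam (delayedName ψ κ) n ≤ m + intervalParam ψ n := by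
  have hψ' := hψ.delayedName hκ hκ'
  obtain ⟨I, hI, hnest, hx⟩ := id hψ
  rw [intervalParam_eq hI hψ] at h ⊢
  rw [intervalParam_eq hI.delayedName hψ']
  set N := sInf {N | (I N).diam ≤ (((2 : ℚ) ^ n)⁻¹ : ℚ)}
  have hN : (I N).diam ≤ (((2 : ℚ) ^ n)⁻¹ : ℚ) :=
    Nat.sInf_mem (s := {N | (I N).diam ≤ (((2 : ℚ) ^ n)⁻¹ : ℚ)})
      (IsIntervalName.exists_diam_le hnest hx (by positivity))
  have hsubset : (delay .infinite I (κ (m + 2))).toSet ⊆ (I N).toSet :=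
    antitone_toSet_delay_infinite hnest (by omega : N + 1 ≤ κ (m + 2))
  have hdiam := (hI.delayedName (κ := κ) m _ (isIntCode_two_pow m)).diam_le_of_toSet_subset hsubset
  exact add_le_add (Nat.sInf_le (hdiam.trans hN)) le_add_self

end DelayedName

/-! ### The delay of the clocked machine -/

namespace Clocked

open Filter

variable {N : OracleMachine} {φ ψ : StringFun}

theorem delayedName_mem_operator_clocked (hψ : ψ ∈ N.operator φ) :
    delayedName ψ (completedRuns N φ) ∈ N.clocked.operator φ := by
  refine OracleMachine.mem_operator_iff.2 fun a => ?_
  obtain ⟨htime, houtput⟩ := time_clocked_le_and_output_eq N φ a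
  refine ⟨ne_top_of_le_ne_top (ENat.natCast_ne_top _) htime, houtput.trans ?_⟩
  simp only [delayedName, (OracleMachine.mem_operator_iff.1 hψ _).2]

theorem totalTime_ne_top (hψ : ψ ∈ N.operator φ) (k : ℕ) : totalTime N φ k ≠ ⊤ :=
  ENat.sum_ne_top.2 fun _ _ =>
    WithTop.add_ne_top.2 ⟨(OracleMachine.mem_operator_iff.1 hψ _).1, ENat.one_ne_top⟩

theorem tendsto_completedRuns (hψ : ψ ∈ N.operator φ) :
    Tendsto (completedRuns N φ) atTop atTop := by
  refine tendsto_atTop_atTop_of_monotone completedRuns_mono fun k => ?_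
  obtain ⟨n, hn⟩ := ENat.ne_top_iff_exists.1 (totalTime_ne_top hψ k)
  exact ⟨n, le_completedRuns_iff.2 hn.ge⟩

theorem totalTime_le_mul {k B : ℕ} (h : ∀ j < k, N.time φ (powCode j) ≤ B) :
    totalTime N φ k ≤ (k * (B + 1) : ℕ) := by
  have hsum := Finset.sum_le_card_nsmul (Finset.range k) _ ((B : ℕ∞) + 1) fun j hj =>
    add_le_add_left (h j (Finset.mem_range.1 hj)) 1
  rwa [Finset.card_range, nsmul_eq_mul, ← Nat.cast_one, ← Nat.cast_add, ← Nat.cast_mul] at hsum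

variable {X : Type*} {SX : PreparametrisedSpace X} {f : X →. ℝ}

theorem isRealiser_clocked (hN : IsRealiser SX intervalReals N.operator f) :
    IsRealiser SX intervalReals N.clocked.operator f := by
  intro φ x y hx hy
  obtain ⟨ψ, hψ, hyψ⟩ := hN φ x y hx hy
  have hname := (mem_intervalRep.1 hyψ).delayedName completedRuns_mono (tendsto_completedRuns hψ)
  exact ⟨_, delayedName_mem_operator_clocked hψ, mem_intervalRep.2 hname⟩

theorem blowupBoundedBy_clocked {P Q : (ℕ → ℕ) → ℕ → ℕ} (hP : IsSecondOrderPolynomial P)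
    (hN : IsRealiser SX intervalReals N.operator f)
    (htime : ∀ φ x, x ∈ SX.rep φ → (f x).Dom → ∀ a, N.time φ a ≤ P (SX.param φ) a.length)
    (hQ : BlowupBoundedBy SX intervalReals N f Q) :
    BlowupBoundedBy SX intervalReals N.clocked f fun l n =>
      (Q l n + 1) * (P l (Q l n + 2) + 1) + Q l n := by
  intro φ x hx hdom ψ' hψ' n
  obtain ⟨ψ, hψ, hyψ⟩ := hN φ x _ hx (Part.get_mem hdom)
  obtain rfl := Part.mem_unique (delayedName_mem_operator_clocked hψ) hψ'
  set l := SX.param φ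
  have hparam : intervalParam ψ n ≤ Q l n := hQ φ x hx hdom ψ hψ n
  have hmono : Monotone (P l) := hP.monotone (monotone_nat_of_le_succ (SX.param_mono φ hx.fst))
  have hrun (j : ℕ) (hj : j < Q l n + 1) : N.time φ (powCode j) ≤ P l (Q l n + 2) := by
    have hlength : (powCode j).length ≤ Q l n + 2 := by
      rw [powCode, (isIntCode_two_pow j).length_eq]
      omega
    exact (htime φ x hx hdom (powCode j)).trans (Nat.cast_le.2 (hmono hlength))
  have hruns : Q l n + 1 ≤ completedRuns N φ ((Q l n + 1) * (P l (Q l n + 2) + 1) + 2) :=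
    le_completedRuns_iff.2 ((totalTime_le_mul hrun).trans (Nat.cast_le.2 le_self_add))
  have hdelay := intervalParam_delayedName_le (mem_intervalRep.1 hyψ) completedRuns_mono
    (tendsto_completedRuns hψ) ((Nat.add_le_add_right hparam 1).trans hruns)
  exact hdelay.trans (Nat.add_le_add_left hparam _)

end Clocked

theorem mainTheorem6_general {X : Type*} (SX : PreparametrisedSpace X) (f : X →. ℝ)
    (hf : IsPolytimeComputable SX intervalReals f) :
    ∃ (M : OracleMachine) (C : ℕ) (P : (ℕ → ℕ) → ℕ → ℕ),
      IsSecondOrderPolynomial P ∧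
      IsRealiser SX intervalReals M.operator f ∧
      (∀ (φ : StringFun) (a : List Letter), M.time φ a ≤ ((C * a.length + C : ℕ) : ℕ∞)) ∧
      BlowupBoundedBy SX intervalReals M f P := by
  obtain ⟨N, P, Q, hP, hQ, hN, htime, hblowup⟩ := hf
  refine ⟨N.clocked, 8, _, ?_, Clocked.isRealiser_clocked hN,
    fun φ a => (Clocked.time_clocked_le_and_output_eq N φ a).1,
    Clocked.blowupBoundedBy_clocked hP hN htime hblowup⟩
  exact ((hQ.add (.const 1)).mul ((hP.comp (hQ.add (.const 2))).add (.const 1))).add hQ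

theorem mainTheorem6 (f : ℝ →. ℝ) (hf : IsPolytimeComputable intervalReals intervalReals f) :
    ∃ (M : OracleMachine) (C : ℕ) (P : (ℕ → ℕ) → ℕ → ℕ),
      IsSecondOrderPolynomial P ∧
      IsRealiser intervalReals intervalReals M.operator f ∧
      (∀ (φ : StringFun) (a : List Letter), M.time φ a ≤ ((C * a.length + C : ℕ) : ℕ∞)) ∧
      BlowupBoundedBy intervalReals intervalReals M f P :=
  mainTheorem6_general intervalReals f hf
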